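/- **Theorem 3 (normal form).** *The theory $\textsc{F-S}$.* Let $\star$ be a one-point set. For finite sets $X,Y$ a substochastic map $S:X\to Y$ is a matrix with entries $S(y|x)\ge 0$ and $\sum_y S(y|x)\le 1$ for every $x$; such maps compose by matrix multiplication and in parallel by $(S\otimes T)(y,y'|x,x')=S(y|x)T(y'|x')$. For a function $f:X\to Y$, $[f]$ denotes the deterministic substochastic map that sends $x$ to $f(x)$ with weight $1$, and for $x\in X$, $[x]:\star\to X$ denotes the point distribution at $x$. The systems are finite arrays of *causal wires* and *inferential wires*, in any order, each labelled by a finite set. Diagrams are built by sequential composition, parallel composition, and crossing of wires (as in any symmetric monoidal category) from the following processes, where $A,B,X,Y$ range over finite sets and $B^A$ is the set of functions $A\to B$: * for every substochastic map $S:X\to Y$, a process $\mathbf{i'}(S)$ with inferential input $X$ and inferential output $Y$; * $\mathrm{know}_{A,B}$, with causal input $A$, inferential input $B^A$ and causal output $B$ (a state of knowledge about the function by which $A$ evolves into $B$); * $\mathrm{ask}_A$, with causal input $A$, causal output $A$ and inferential output $A$ (knowledge is gained about $A$); * $\mathrm{ignore}_A$, with causal input $A$ and no output. Two parallel wires of the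 same kind with labels $X,Y$ are identified with one wire labelled $X\times Y$, and a wire labelled $\star$ is identified with no wire. Write $\mathrm{discard}_X$ for $\mathbf{i'}$ of the all-ones effect $X\to\star$, $\mathrm{copy}_X=\mathbf{i'}([x\mapsto(x,x)])$, and $\mathbf{e'}(f)$ for $\mathrm{know}_{A,B}$ with the point distribution $[f]$ on its inferential input. Two diagrams can be *rewritten* into each other if they are related by the least congruence that contains the laws of wiring and the following rules: 1. $\mathbf{i'}$ preserves identities, swaps, sequential composition and parallel composition; 2. $\mathbf{e'}$ of an identity function is an identity wire, and $\mathbf{e'}$ of a swap is a crossing of wires; 3. $\mathrm{know}_{A,B}$ followed by $\mathrm{know}_{B,C}$ equals $\mathbf{i'}([(f,g)\mapsto g\circ f])$ followed by $\mathrm{know}_{A,C}$; and $\mathrm{know}_{A,B}$ in parallel with $\mathrm{know}_{A',B'}$ equals $\mathbf{i'}([(f,g)\mapsto f\times g])$ followed by $\mathrm{know}_{A\times A',B\times B'}$; 4. $\mathrm{ask}_A$ with its inferential output discarded equals the identity; asking twice in sequence equals asking once and copying the inferential output; and $\mathrm{ask}_{A\times B}$ equals $\mathrm{ask}_A$ in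 parallel with $\mathrm{ask}_B$; 5. $\mathrm{ignore}_{A\times B}$ equals $\mathrm{ignore}_A$ in parallel with $\mathrm{ignore}_B$; $\mathrm{ignore}_\star$ is the empty diagram; and $\mathrm{know}_{A,B}$ followed by $\mathrm{ignore}_B$ equals $\mathrm{ignore}_A$ in parallel with $\mathrm{discard}_{B^A}$; 6. (propagation of knowledge through functions) $\mathrm{know}_{A,B}$ followed by $\mathrm{ask}_B$ equals the following diagram: apply $\mathrm{ask}_A$ to $A$ and $\mathrm{copy}$ to the inferential wire $B^A$; feed the causal wire $A$ and one copy of $B^A$ into $\mathrm{know}_{A,B}$, and feed the inferential output of $\mathrm{ask}_A$ and the other copy of $B^A$ into $\mathbf{i'}([(a,f)\mapsto f(a)])$. *Normal forms.* Given a substochastic map $S:A\times X\to B^A\times Y$, the normal form $N(S)$ is the diagram with causal input $A$, inferential input $X$, causal output $B$ and inferential output $Y$ that is built as follows: $\mathrm{ask}_A$ is applied to the causal wire $A$; its inferential output and the input $X$ are fed into $\mathbf{i'}(S)$; the output $B^A$ of $\mathbf{i'}(S)$ and the causal wire $A$ are fed into $\mathrm{know}_{A,B}$, whose output is the causal output $B$;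 and the output $Y$ of $\mathbf{i'}(S)$ is the inferential output. *Theorem.* Every diagram of $\textsc{F-S}$ can be rewritten into normal form. That is, for all finite sets $A,B,X,Y$ and every diagram $\mathcal D$ with causal input $A$, inferential input $X$, causal output $B$ and inferential output $Y$, there is a substochastic map $S:A\times X\to B^A\times Y$ such that $\mathcal D$ can be rewritten into $N(S)$. Likewise, every diagram between arbitrary arrays of causal and inferential wires can be rewritten into a diagram of the following form, for some substochastic map $S$: gather the causal input wires into one causal wire and the inferential input wires into one inferential wire, apply $N(S)$, and spread the two output wires out into the given output array. -/

import Mathlib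

universe u

namespace FS

/-! ## Finite sets, functions and substochastic maps -/

/-- A finite set, the label of a causal or of an inferential system. -/
structure FinSys : Type (u + 1) where
  carrier : Type u
  [fintype : Fintype carrier]
  [decEq : DecidableEq carrier]

namespace FinSys

instance : CoeSort FinSys.{u} (Type u) := ⟨FinSys.carrier⟩

instance (X : FinSys.{u}) : Fintype X := X.fintype

instance (X : FinSys.{u}) : DecidableEq X := X.decEq

/-- The trivial system: the one-point set. -/
abbrev star : FinSys.{u} := ⟨PUnit.{u + 1}⟩

/-- The composite of two systems: the Cartesian product. -/
abbrev prod (X Y : FinSys.{u}) : FinSys.{u} := ⟨X × Y⟩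

/-- The finite set of all functions from `X` to `Y`. -/
abbrev fn (X Y : FinSys.{u}) : FinSys.{u} := ⟨X → Y⟩

end FinSys

/-- Substochastic maps from `X` to `Y`: `S x y` is the weight of `y` given `x`, the weights are
nonnegative, and for each `x` their sum is at most one. -/
@[ext]
structure SubStoch (X Y : FinSys.{u}) where
  toFun : X → Y → ℝ
  nonneg : ∀ x y, 0 ≤ toFun x y
  sum_le_one : ∀ x, ∑ y, toFun x y ≤ 1

namespace SubStoch

variable {X Y Z X' Y' : FinSys.{u}}

/-- The deterministic stochastic map of a function: the point distribution `[x]` is sent to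
`[f x]`. -/
def ofFun (f : X → Y) : SubStoch X Y where
  toFun x y := if f x = y then 1 else 0
  nonneg x y := by split_ifs <;> norm_num
  sum_le_one x := by simp

/-- Sequential composition: `S` first, then `T`. -/
def comp (S : SubStoch X Y) (T : SubStoch Y Z) : SubStoch X Z where
  toFun x z := ∑ y, S.toFun x y * T.toFun y z
  nonneg x z := Finset.sum_nonneg fun y _ => mul_nonneg (S.nonneg x y) (T.nonneg y z)
  sum_le_one x := by
    rw [Finset.sum_comm]
    calc ∑ y, ∑ z, S.toFun x y * T.toFun y z
        = ∑ y, S.toFun x y * ∑ z, T.toFun y z := by simp_rw [Finset.mul_sum]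
      _ ≤ ∑ y, S.toFun x y :=
          Finset.sum_le_sum fun y _ => mul_le_of_le_one_right (S.nonneg x y) (T.sum_le_one y)
      _ ≤ 1 := S.sum_le_one x

/-- Parallel composition. -/
def tensor (S : SubStoch X Y) (T : SubStoch X' Y') : SubStoch (X.prod X') (Y.prod Y') where
  toFun x y := S.toFun x.1 y.1 * T.toFun x.2 y.2
  nonneg x y := mul_nonneg (S.nonneg _ _) (T.nonneg _ _)
  sum_le_one x := by
    have h : ∑ y : (Y.prod Y' : FinSys.{u}), S.toFun x.1 y.1 * T.toFun x.2 y.2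
        = (∑ y, S.toFun x.1 y) * ∑ y', T.toFun x.2 y' := by
      rw [Finset.sum_mul_sum]
      exact Fintype.sum_prod_type (fun y : Y × Y' => S.toFun x.1 y.1 * T.toFun x.2 y.2)
    rw [h]
    exact mul_le_one₀ (S.sum_le_one _) (Finset.sum_nonneg fun y _ => T.nonneg _ y)
      (T.sum_le_one _)

/-- The identity. -/
def one (X : FinSys.{u}) : SubStoch X X := ofFun fun x => x

/-- The point distribution `[x]`. -/
def point (x : X) : SubStoch FinSys.star X := ofFun fun _ => x

/-- The black dot: broadcasting, `[x] ↦ [x] ⊗ [x]`. -/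
def copy (X : FinSys.{u}) : SubStoch X (X.prod X) := ofFun fun x => (x, x)

/-- Marginalisation over `X`, which is also the tautological proposition about `X`. -/
def discard (X : FinSys.{u}) : SubStoch X FinSys.star := ofFun fun _ => PUnit.unit

/-- The exchange of two systems. -/
def swap (X Y : FinSys.{u}) : SubStoch (X.prod Y) (Y.prod X) := ofFun fun p => (p.2, p.1)

/-- Rebracketing of a composite of three systems. -/
def assoc (X Y Z : FinSys.{u}) : SubStoch ((X.prod Y).prod Z) (X.prod (Y.prod Z)) :=
  ofFun fun p => (p.1.1, (p.1.2, p.2))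

/-- Removal of a trivial system on the left. -/
def lunit (X : FinSys.{u}) : SubStoch (FinSys.star.prod X) X := ofFun fun p => p.2

/-- Removal of a trivial system on the right. -/
def runit (X : FinSys.{u}) : SubStoch (X.prod FinSys.star) X := ofFun fun p => p.1

/-- Knowledge about a sequential composite: `[f] ⊗ [g] ↦ [g ∘ f]`. -/
def seqComp (A B C : FinSys.{u}) : SubStoch ((A.fn B).prod (B.fn C)) (A.fn C) :=
  ofFun fun p a => p.2 (p.1 a)

/-- Knowledge about a parallel composite: `[f] ⊗ [g] ↦ [f × g]`. -/
def parComp (A B A' B' : FinSys.{u}) :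
    SubStoch ((A.fn B).prod (A'.fn B')) ((A.prod A').fn (B.prod B')) :=
  ofFun fun p a => (p.1 a.1, p.2 a.2)

/-- The black diamond: propagation of knowledge through a function, `[a] ⊗ [f] ↦ [f a]`. -/
def apply (A B : FinSys.{u}) : SubStoch (A.prod (A.fn B)) B := ofFun fun p => p.2 p.1

end SubStoch

/-! ## Systems and diagrams -/

/-- The systems of the theory: (bracketed) finite arrays of causal wires and inferential wires, in
any order; `I` is the empty array. -/
inductive Ob : Type (u + 1)
  | I : Ob
  | causal (A : FinSys.{u}) : Ob
  | infer (X : FinSys.{u}) : Ob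
  | tens (a b : Ob) : Ob

open Ob

/-- Diagrams, written as terms. The first group is bare wiring (identities, the two compositions,
rebracketing, crossing of wires); the second group regards two parallel wires of one kind as a
single wire that carries the Cartesian product, and the empty array as a wire that carries the
one-point set; the last group holds the substochastic maps, included by `i'`, and the three
generators of interactions between causal and inferential systems. -/
inductive Diag : Ob.{u} → Ob.{u} → Type (u + 1)
  | wire (a : Ob) : Diag a a
  | comp {a b c : Ob} (f : Diag a b) (g : Diag b c) : Diag a c
  | tensor {a b c d : Ob} (f : Diag a b) (g : Diag c d) : Diag (tens a c) (tens b d)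
  | assoc (a b c : Ob) : Diag (tens (tens a b) c) (tens a (tens b c))
  | assocInv (a b c : Ob) : Diag (tens a (tens b c)) (tens (tens a b) c)
  | lunit (a : Ob) : Diag (tens I a) a
  | lunitInv (a : Ob) : Diag a (tens I a)
  | runit (a : Ob) : Diag (tens a I) a
  | runitInv (a : Ob) : Diag a (tens a I)
  | braid (a b : Ob) : Diag (tens a b) (tens b a)
  | inferMerge (X Y : FinSys.{u}) : Diag (tens (infer X) (infer Y)) (infer (X.prod Y))
  | inferSplit (X Y : FinSys.{u}) : Diag (infer (X.prod Y)) (tens (infer X) (infer Y))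
  | inferUnit : Diag I (infer FinSys.star)
  | inferCounit : Diag (infer FinSys.star) I
  | causalMerge (A B : FinSys.{u}) : Diag (tens (causal A) (causal B)) (causal (A.prod B))
  | causalSplit (A B : FinSys.{u}) : Diag (causal (A.prod B)) (tens (causal A) (causal B))
  | causalUnit : Diag I (causal FinSys.star)
  | causalCounit : Diag (causal FinSys.star) I
  /-- The inclusion `i'` of substochastic maps. -/
  | incl {X Y : FinSys.{u}} (S : SubStoch X Y) : Diag (infer X) (infer Y)
  /-- State of knowledge about the function by which the system `A` evolves into `B`. -/
  | know (A B : FinSys.{u}) : Diag (tens (causal A) (infer (A.fn B))) (causal B)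
  /-- Gaining knowledge of (asking a question about) the system `A`, which is passed on. -/
  | ask (A : FinSys.{u}) : Diag (causal A) (tens (causal A) (infer A))
  /-- Ignoring the system `A`. -/
  | ignore (A : FinSys.{u}) : Diag (causal A) I

infixr:80 " ;; " => Diag.comp

infixr:90 " ⊗ₚ " => Diag.tensor

namespace Diag

/-- Exchange of the two middle (bundles of) wires among four. -/
def mid (a b c d : Ob.{u}) : Diag (tens (tens a b) (tens c d)) (tens (tens a c) (tens b d)) :=
  assoc a b (tens c d) ;;
    (wire a ⊗ₚ (assocInv b c d ;; (braid b c ⊗ₚ wire d) ;; assoc c b d)) ;;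
      assocInv a c (tens b d)

/-- The broadcasting map, with its output drawn as two wires. -/
def copy (X : FinSys.{u}) : Diag (infer X) (tens (infer X) (infer X)) :=
  incl (SubStoch.copy X) ;; inferSplit X X

/-- Marginalisation, with no output wire. -/
def discard (X : FinSys.{u}) : Diag (infer X) I :=
  incl (SubStoch.discard X) ;; inferCounit

/-- The point distribution `[x]`, with no input wire. -/
def point {X : FinSys.{u}} (x : X) : Diag I (infer X) :=
  inferUnit ;; incl (SubStoch.point x)

/-- The embedding `e'` of functional dynamics: certain knowledge that the dynamics is `f`. -/
def embed {A B : FinSys.{u}} (f : A → B) : Diag (causal A) (causal B) :=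
  runitInv (causal A) ;; (wire (causal A) ⊗ₚ point (X := A.fn B) f) ;; know A B

end Diag

open Diag

/-! ## Rewriting -/

/-- `Rewrites D E`: the diagram `D` can be rewritten into `E`. It is the least congruence that
contains the laws of wiring (those of a symmetric monoidal category), the preservation of diagrams
by `i'` and by `e'`, and the rules for the three generators. -/
inductive Rewrites : {a b : Ob.{u}} → Diag a b → Diag a b → Prop
  -- congruence
  | refl {a b} (f : Diag a b) : Rewrites f f
  | symm {a b} {f g : Diag a b} : Rewrites f g → Rewrites g f
  | trans {a b} {f g h : Diag a b} : Rewrites f g → Rewrites g h → Rewrites f h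
  | comp_congr {a b c} {f f' : Diag a b} {g g' : Diag b c} :
      Rewrites f f' → Rewrites g g' → Rewrites (f ;; g) (f' ;; g')
  | tensor_congr {a b c d} {f f' : Diag a b} {g g' : Diag c d} :
      Rewrites f f' → Rewrites g g' → Rewrites (f ⊗ₚ g) (f' ⊗ₚ g')
  -- sequential and parallel composition
  | id_comp {a b} (f : Diag a b) : Rewrites (wire a ;; f) f
  | comp_id {a b} (f : Diag a b) : Rewrites (f ;; wire b) f
  | comp_assoc {a b c d} (f : Diag a b) (g : Diag b c) (h : Diag c d) :
      Rewrites ((f ;; g) ;; h) (f ;; (g ;; h))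
  | tensor_id (a b) : Rewrites (wire a ⊗ₚ wire b) (wire (tens a b))
  | tensor_comp {a b c a' b' c'} (f : Diag a b) (g : Diag b c) (f' : Diag a' b')
      (g' : Diag b' c') :
      Rewrites ((f ;; g) ⊗ₚ (f' ;; g')) ((f ⊗ₚ f') ;; (g ⊗ₚ g'))
  -- rebracketing
  | assoc_inv (a b c) : Rewrites (assoc a b c ;; assocInv a b c) (wire _)
  | inv_assoc (a b c) : Rewrites (assocInv a b c ;; assoc a b c) (wire _)
  | assoc_nat {a b c a' b' c'} (f : Diag a a') (g : Diag b b') (h : Diag c c') :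
      Rewrites (((f ⊗ₚ g) ⊗ₚ h) ;; assoc a' b' c') (assoc a b c ;; (f ⊗ₚ (g ⊗ₚ h)))
  | lunit_inv (a) : Rewrites (lunit a ;; lunitInv a) (wire _)
  | inv_lunit (a) : Rewrites (lunitInv a ;; lunit a) (wire _)
  | lunit_nat {a b} (f : Diag a b) : Rewrites ((wire I ⊗ₚ f) ;; lunit b) (lunit a ;; f)
  | runit_inv (a) : Rewrites (runit a ;; runitInv a) (wire _)
  | inv_runit (a) : Rewrites (runitInv a ;; runit a) (wire _)
  | runit_nat {a b} (f : Diag a b) : Rewrites ((f ⊗ₚ wire I) ;; runit b) (runit a ;; f)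
  | pentagon (a b c d) :
      Rewrites ((assoc a b c ⊗ₚ wire d) ;; assoc a (tens b c) d ;; (wire a ⊗ₚ assoc b c d))
        (assoc (tens a b) c d ;; assoc a b (tens c d))
  | triangle (a b) : Rewrites (assoc a I b ;; (wire a ⊗ₚ lunit b)) (runit a ⊗ₚ wire b)
  -- crossing of wires
  | braid_nat {a b a' b'} (f : Diag a a') (g : Diag b b') :
      Rewrites ((f ⊗ₚ g) ;; braid a' b') (braid a b ;; (g ⊗ₚ f))
  | braid_braid (a b) : Rewrites (braid a b ;; braid b a) (wire _)
  | hexagon (a b c) :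
      Rewrites (assoc a b c ;; braid a (tens b c) ;; assoc b c a)
        ((braid a b ⊗ₚ wire c) ;; assoc b a c ;; (wire b ⊗ₚ braid a c))
  -- parallel inferential wires form one wire, and `i'` preserves diagrams
  | inferMerge_split (X Y) : Rewrites (inferMerge X Y ;; inferSplit X Y) (wire _)
  | inferSplit_merge (X Y) : Rewrites (inferSplit X Y ;; inferMerge X Y) (wire _)
  | inferUnit_counit : Rewrites (inferUnit ;; inferCounit) (wire _)
  | inferCounit_unit : Rewrites (inferCounit ;; inferUnit) (wire _)
  | incl_one (X) : Rewrites (incl (SubStoch.one X)) (wire _)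
  | incl_comp {X Y Z} (S : SubStoch X Y) (T : SubStoch Y Z) :
      Rewrites (incl (S.comp T)) (incl S ;; incl T)
  | incl_tensor {X Y X' Y'} (S : SubStoch X Y) (T : SubStoch X' Y') :
      Rewrites (inferMerge X X' ;; incl (S.tensor T)) ((incl S ⊗ₚ incl T) ;; inferMerge Y Y')
  | incl_assoc (X Y Z) :
      Rewrites ((inferMerge X Y ⊗ₚ wire _) ;; inferMerge (X.prod Y) Z ;; incl (SubStoch.assoc X Y Z))
        (assoc _ _ _ ;; (wire _ ⊗ₚ inferMerge Y Z) ;; inferMerge X (Y.prod Z))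
  | incl_lunit (X) :
      Rewrites ((inferUnit ⊗ₚ wire _) ;; inferMerge FinSys.star X ;; incl (SubStoch.lunit X))
        (lunit _)
  | incl_runit (X) :
      Rewrites ((wire _ ⊗ₚ inferUnit) ;; inferMerge X FinSys.star ;; incl (SubStoch.runit X))
        (runit _)
  | incl_swap (X Y) :
      Rewrites (inferMerge X Y ;; incl (SubStoch.swap X Y)) (braid _ _ ;; inferMerge Y X)
  -- parallel causal wires form one wire; the identity, and the wirings that become invisible or
  -- a swap when pairs of wires are regarded as single wires, are the point distributions on the
  -- corresponding functions
  | causalMerge_split (A B) : Rewrites (causalMerge A B ;; causalSplit A B) (wire _)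
  | causalSplit_merge (A B) : Rewrites (causalSplit A B ;; causalMerge A B) (wire _)
  | causalUnit_counit : Rewrites (causalUnit ;; causalCounit) (wire _)
  | causalCounit_unit : Rewrites (causalCounit ;; causalUnit) (wire _)
  | embed_id (A : FinSys) : Rewrites (embed (A := A) (B := A) fun x => x) (wire _)
  | embed_assoc (A B C : FinSys) :
      Rewrites ((causalMerge A B ⊗ₚ wire _) ;; causalMerge (A.prod B) C ;;
          embed (B := A.prod (B.prod C)) fun p => (p.1.1, (p.1.2, p.2)))
        (assoc _ _ _ ;; (wire _ ⊗ₚ causalMerge B C) ;; causalMerge A (B.prod C))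
  | embed_lunit (A : FinSys) :
      Rewrites ((causalUnit ⊗ₚ wire _) ;; causalMerge FinSys.star A ;; embed fun p => p.2) (lunit _)
  | embed_runit (A : FinSys) :
      Rewrites ((wire _ ⊗ₚ causalUnit) ;; causalMerge A FinSys.star ;; embed fun p => p.1) (runit _)
  | embed_swap (A B : FinSys) :
      Rewrites (causalMerge A B ;; embed (B := B.prod A) fun p => (p.2, p.1))
        (braid _ _ ;; causalMerge B A)
  -- knowledge about sequential and about parallel composites
  | know_seq (A B C) :
      Rewrites ((know A B ⊗ₚ wire _) ;; know B C)
        (assoc _ _ _ ;;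
          (wire _ ⊗ₚ (inferMerge _ _ ;; incl (SubStoch.seqComp A B C))) ;; know A C)
  | know_par (A B A' B') :
      Rewrites ((know A B ⊗ₚ know A' B') ;; causalMerge B B')
        (mid _ _ _ _ ;;
          (causalMerge A A' ⊗ₚ (inferMerge _ _ ;; incl (SubStoch.parComp A B A' B'))) ;;
            know (A.prod A') (B.prod B'))
  -- asking the tautological question, asking twice, asking about a composite system
  | ask_discard (A) : Rewrites (ask A ;; (wire _ ⊗ₚ discard A) ;; runit _) (wire _)
  | ask_ask (A) :
      Rewrites (ask A ;; (ask A ⊗ₚ wire _) ;; assoc _ _ _) (ask A ;; (wire _ ⊗ₚ copy A))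
  | ask_par (A B) :
      Rewrites (causalMerge A B ;; ask (A.prod B))
        ((ask A ⊗ₚ ask B) ;; mid _ _ _ _ ;; (causalMerge A B ⊗ₚ inferMerge A B))
  -- ignoring a composite system, the trivial system, the output of a function
  | ignore_par (A B) :
      Rewrites (causalMerge A B ;; ignore (A.prod B)) ((ignore A ⊗ₚ ignore B) ;; lunit I)
  | ignore_star : Rewrites (ignore FinSys.star) causalCounit
  | ignore_know (A B) :
      Rewrites (know A B ;; ignore B) ((ignore A ⊗ₚ discard (A.fn B)) ;; lunit I)
  -- propagation of knowledge through functions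
  | know_ask (A B) :
      Rewrites (know A B ;; ask B)
        ((ask A ⊗ₚ copy (A.fn B)) ;; mid _ _ _ _ ;;
          (know A B ⊗ₚ (inferMerge _ _ ;; incl (SubStoch.apply A B))))

/-! ## Normal forms -/

/-- The normal form given by a substochastic map `S` from `A × X` to `(A → B) × Y`: the causal
system `A` is asked about, `S` takes the answer together with the inferential input `X`, and its
first output is the state of knowledge about the function by which the system `A` evolves into the
causal output `B`; its second output is the inferential output `Y`. -/
def normalForm {A B X Y : FinSys.{u}} (S : SubStoch (A.prod X) ((A.fn B).prod Y)) :
    Diag (tens (causal A) (infer X)) (tens (causal B) (infer Y)) :=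
  (ask A ⊗ₚ wire (infer X)) ;;
    assoc _ _ _ ;;
      (wire (causal A) ⊗ₚ (inferMerge A X ;; incl S ;; inferSplit (A.fn B) Y)) ;;
        assocInv _ _ _ ;;
          (know A B ⊗ₚ wire (infer Y))

namespace Ob

/-- The composite of all causal wires of an array. -/
def causalPart : Ob.{u} → FinSys.{u}
  | I => FinSys.star
  | causal A => A
  | infer _ => FinSys.star
  | tens a b => (causalPart a).prod (causalPart b)

/-- The composite of all inferential wires of an array. -/
def inferPart : Ob.{u} → FinSys.{u}
  | I => FinSys.star
  | causal _ => FinSys.star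
  | infer X => X
  | tens a b => (inferPart a).prod (inferPart b)

end Ob

/-- The wiring that brings the causal wires of an array to the left, the inferential wires to the
right, and regards either bundle as one wire. -/
def gather : (a : Ob.{u}) → Diag a (tens (causal a.causalPart) (infer a.inferPart))
  | I => lunitInv I ;; (causalUnit ⊗ₚ inferUnit)
  | causal A => runitInv (causal A) ;; (wire (causal A) ⊗ₚ inferUnit)
  | infer X => lunitInv (infer X) ;; (causalUnit ⊗ₚ wire (infer X))
  | tens a b => (gather a ⊗ₚ gather b) ;; mid _ _ _ _ ;; (causalMerge _ _ ⊗ₚ inferMerge _ _)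

/-- The reverse wiring. -/
def spread : (a : Ob.{u}) → Diag (tens (causal a.causalPart) (infer a.inferPart)) a
  | I => (causalCounit ⊗ₚ inferCounit) ;; lunit I
  | causal A => (wire (causal A) ⊗ₚ inferCounit) ;; runit (causal A)
  | infer X => (causalCounit ⊗ₚ wire (infer X)) ;; lunit (infer X)
  | tens a b => (causalSplit _ _ ⊗ₚ inferSplit _ _) ;; mid _ _ _ _ ;; (spread a ⊗ₚ spread b)

end FS

namespace FS

open CategoryTheory MonoidalCategory

/-! ## The symmetric monoidal category of diagrams up to rewriting -/

/-! Modulo rewriting, diagrams form a symmetric monoidal category, so bare wiring can be handled by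
coherence and naturality. Call a morphism normal (`IsNormal`) if it asks about its causal input,
runs an inferential morphism on the answer and the inferential input, and feeds the resulting
function into `know`. Nothing is lost by allowing any inferential morphism in the middle: a
composite of substochastic maps and wiring between inferential arrays is, once the wires are merged,
a single substochastic map (`Inferential`).

The heart of the matter is closure under composition (`IsNormal.comp`). Where two normal morphisms
meet, a `know` is followed by an `ask`. The propagation rule (`knowOn_askOn`) trades this for an
`ask` followed by a `know`. The new `ask` slides back past the first inferential part and fuses with
the first `ask`, at the cost of copying the answer; the new `know` slides forward past the second
inferential part and fuses with the last `know`, at the cost of composing functions. Everything in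
between is inferential.

For parallel composition it suffices to place an idle bundle beside a normal morphism
(`IsNormal.tensor_left`). An idle causal wire can be asked with the answer discarded, and it evolves
by the known identity function; the parallel rules for `ask` and `know` then absorb it.

The theorem follows by induction on diagrams (`normalVia_gatherIso`), with every array gathered into
one causal and one inferential wire. Structural wiring becomes a pair of bijections on the two
bundles, which is normal because embedded functions and deterministic maps are; the generators are
normal after padding with trivial wires. -/

/-- Rewriting as an equivalence relation on diagrams. -/
instance diagSetoid (a b : Ob.{u}) : Setoid (Diag a b) where
  r := Rewrites
  iseqv := ⟨Rewrites.refl, Rewrites.symm, Rewrites.trans⟩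

instance : CategoryStruct Ob.{u} where
  Hom a b := Quotient (diagSetoid a b)
  id a := Quotient.mk _ (Diag.wire a)
  comp f g := Quotient.map₂ Diag.comp (fun _ _ h _ _ k => Rewrites.comp_congr h k) f g

/-- The class of a diagram. -/
def cls {a b : Ob.{u}} (D : Diag a b) : a ⟶ b := Quotient.mk (diagSetoid a b) D

theorem cls_eq {a b : Ob.{u}} {D E : Diag a b} (h : Rewrites D E) : cls D = cls E :=
  Quotient.sound h

theorem rewrites_of_cls_eq {a b : Ob.{u}} {D E : Diag a b} (h : cls D = cls E) : Rewrites D E :=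
  Quotient.exact h

theorem cls_surjective {a b : Ob.{u}} (f : a ⟶ b) : ∃ D, cls D = f := Quotient.exists_rep f

theorem cls_wire (a : Ob.{u}) : cls (Diag.wire a) = 𝟙 a := rfl

theorem cls_comp {a b c : Ob.{u}} (D : Diag a b) (E : Diag b c) :
    cls (D ;; E) = cls D ≫ cls E := rfl

instance : Category Ob.{u} where
  id_comp f := by
    obtain ⟨f, rfl⟩ := cls_surjective f
    exact cls_eq (Rewrites.id_comp f)
  comp_id f := by
    obtain ⟨f, rfl⟩ := cls_surjective f
    exact cls_eq (Rewrites.comp_id f)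
  assoc f g h := by
    obtain ⟨f, rfl⟩ := cls_surjective f
    obtain ⟨g, rfl⟩ := cls_surjective g
    obtain ⟨h, rfl⟩ := cls_surjective h
    exact cls_eq (Rewrites.comp_assoc f g h)

/-- Parallel composition of classes of diagrams. -/
def clsTensor {a b c d : Ob.{u}} (f : a ⟶ b) (g : c ⟶ d) : Ob.tens a c ⟶ Ob.tens b d :=
  Quotient.map₂ Diag.tensor (fun _ _ h _ _ k => Rewrites.tensor_congr h k) f g

instance : MonoidalCategoryStruct Ob.{u} where
  tensorObj := Ob.tens
  tensorUnit := Ob.I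
  tensorHom := clsTensor
  whiskerLeft a _ _ f := clsTensor (𝟙 a) f
  whiskerRight f a := clsTensor f (𝟙 a)
  associator a b c :=
    { hom := cls (Diag.assoc a b c)
      inv := cls (Diag.assocInv a b c)
      hom_inv_id := cls_eq (Rewrites.assoc_inv a b c)
      inv_hom_id := cls_eq (Rewrites.inv_assoc a b c) }
  leftUnitor a :=
    { hom := cls (Diag.lunit a)
      inv := cls (Diag.lunitInv a)
      hom_inv_id := cls_eq (Rewrites.lunit_inv a)
      inv_hom_id := cls_eq (Rewrites.inv_lunit a) }
  rightUnitor a :=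
    { hom := cls (Diag.runit a)
      inv := cls (Diag.runitInv a)
      hom_inv_id := cls_eq (Rewrites.runit_inv a)
      inv_hom_id := cls_eq (Rewrites.inv_runit a) }

theorem cls_tensor {a b c d : Ob.{u}} (D : Diag a b) (E : Diag c d) :
    cls (D ⊗ₚ E) = cls D ⊗ₘ cls E := rfl

instance : MonoidalCategory Ob.{u} :=
  MonoidalCategory.ofTensorHom
    (id_tensorHom_id := fun a b => cls_eq (Rewrites.tensor_id a b))
    (id_tensorHom := fun _ _ _ _ => rfl)
    (tensorHom_id := fun _ _ => rfl)
    (tensorHom_comp_tensorHom := fun f f' g g' => by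
      obtain ⟨f, rfl⟩ := cls_surjective f
      obtain ⟨g, rfl⟩ := cls_surjective g
      obtain ⟨f', rfl⟩ := cls_surjective f'
      obtain ⟨g', rfl⟩ := cls_surjective g'
      exact (cls_eq (Rewrites.tensor_comp f g f' g')).symm)
    (associator_naturality := fun f g h => by
      obtain ⟨f, rfl⟩ := cls_surjective f
      obtain ⟨g, rfl⟩ := cls_surjective g
      obtain ⟨h, rfl⟩ := cls_surjective h
      exact cls_eq (Rewrites.assoc_nat f g h))
    (leftUnitor_naturality := fun f => by
      obtain ⟨f, rfl⟩ := cls_surjective f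
      exact cls_eq (Rewrites.lunit_nat f))
    (rightUnitor_naturality := fun f => by
      obtain ⟨f, rfl⟩ := cls_surjective f
      exact cls_eq (Rewrites.runit_nat f))
    (pentagon := fun a b c d => cls_eq (Rewrites.pentagon a b c d))
    (triangle := fun a b => cls_eq (Rewrites.triangle a b))

/-- Crossing of wires, as an isomorphism. -/
def crossing (a b : Ob.{u}) : a ⊗ b ≅ b ⊗ a where
  hom := cls (Diag.braid a b)
  inv := cls (Diag.braid b a)
  hom_inv_id := cls_eq (Rewrites.braid_braid a b)
  inv_hom_id := cls_eq (Rewrites.braid_braid b a)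

theorem crossing_natural {a b a' b' : Ob.{u}} (f : a ⟶ a') (g : b ⟶ b') :
    (f ⊗ₘ g) ≫ (crossing a' b').hom = (crossing a b).hom ≫ (g ⊗ₘ f) := by
  obtain ⟨f, rfl⟩ := cls_surjective f
  obtain ⟨g, rfl⟩ := cls_surjective g
  exact cls_eq (Rewrites.braid_nat f g)

theorem crossing_hexagon (a b c : Ob.{u}) :
    (α_ a b c).hom ≫ (crossing a (b ⊗ c)).hom ≫ (α_ b c a).hom =
      (crossing a b).hom ▷ c ≫ (α_ b a c).hom ≫ b ◁ (crossing a c).hom :=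
  cls_eq (Rewrites.hexagon a b c)

theorem crossing_inv (a b : Ob.{u}) : (crossing a b).inv = (crossing b a).hom := rfl

instance : SymmetricCategory Ob.{u} where
  braiding := crossing
  braiding_naturality_right a _ _ f := by
    rw [← id_tensorHom, ← tensorHom_id, crossing_natural]
  braiding_naturality_left f a := by
    rw [← id_tensorHom, ← tensorHom_id, crossing_natural]
  hexagon_forward := crossing_hexagon
  hexagon_reverse a b c := by
    -- Only one hexagon is a rule. The other is its inverse at a permuted triple, because a crossing
    -- is inverse to the opposite crossing.
    have h := crossing_hexagon c a b
    rw [← cancel_epi ((crossing c (a ⊗ b)).hom ≫ (α_ a b c).hom), ← cancel_epi (α_ c a b).hom,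
      ← crossing_inv c (a ⊗ b), ← crossing_inv c b, ← crossing_inv c a]
    simp only [Category.assoc, Iso.hom_inv_id_assoc, Iso.hom_inv_id]
    have h' := h =≫ (a ◁ (crossing c b).inv ≫ (α_ a c b).inv ≫ (crossing c a).inv ▷ b)
    simp only [Category.assoc] at h'
    rw [h']
    simp
  symmetry a b := (crossing a b).hom_inv_id

theorem cls_assoc (a b c : Ob.{u}) : cls (Diag.assoc a b c) = (α_ a b c).hom := rfl
theorem cls_assocInv (a b c : Ob.{u}) : cls (Diag.assocInv a b c) = (α_ a b c).inv := rfl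
theorem cls_braid (a b : Ob.{u}) : cls (Diag.braid a b) = (β_ a b).hom := rfl

theorem cls_mid (a b c d : Ob.{u}) : cls (Diag.mid a b c d) = tensorμ a b c d := by
  simp only [Diag.mid, cls_comp, cls_tensor, cls_assoc, cls_assocInv, cls_braid, cls_wire,
    tensorμ]
  change (α_ a b (c ⊗ d)).hom ≫ ((𝟙 a ⊗ₘ ((α_ b c d).inv ≫ ((β_ b c).hom ⊗ₘ 𝟙 d) ≫ (α_ c b d).hom))
    ≫ (α_ a c (b ⊗ d)).inv) = _
  simp only [id_tensorHom, tensorHom_id, MonoidalCategory.whiskerLeft_comp, Category.assoc]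

/-! ## Inferential diagrams -/

namespace SubStoch

theorem ofFun_comp {X Y Z : FinSys.{u}} (f : X → Y) (g : Y → Z) :
    (ofFun f).comp (ofFun g) = ofFun fun x => g (f x) := by
  ext x z
  simp only [comp, ofFun, ite_mul, one_mul, zero_mul, Finset.sum_ite_eq, Finset.mem_univ, if_true]

theorem ofFun_tensor {X Y X' Y' : FinSys.{u}} (f : X → Y) (g : X' → Y') :
    (ofFun f).tensor (ofFun g) =
      (ofFun fun p => (f p.1, g p.2) : SubStoch (X.prod X') (Y.prod Y')) := by
  ext x y
  obtain ⟨y, y'⟩ := y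
  simp only [tensor, ofFun, Prod.mk.injEq]
  by_cases h : f x.1 = y <;> by_cases h' : g x.2 = y' <;> simp [h, h']

end SubStoch

/-- The class of an included substochastic map. -/
def inc {X Y : FinSys.{u}} (S : SubStoch X Y) : Ob.infer X ⟶ Ob.infer Y := cls (Diag.incl S)

/-- The class of an included function. -/
def det {X Y : FinSys.{u}} (f : X → Y) : Ob.infer X ⟶ Ob.infer Y := inc (SubStoch.ofFun f)

/-- Two inferential wires as one. -/
def inferProd (X Y : FinSys.{u}) : Ob.infer X ⊗ Ob.infer Y ≅ Ob.infer (X.prod Y) where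
  hom := cls (Diag.inferMerge X Y)
  inv := cls (Diag.inferSplit X Y)
  hom_inv_id := cls_eq (Rewrites.inferMerge_split X Y)
  inv_hom_id := cls_eq (Rewrites.inferSplit_merge X Y)

/-- No wire as an inferential wire. -/
def inferStar : 𝟙_ Ob.{u} ≅ Ob.infer FinSys.star.{u} where
  hom := cls Diag.inferUnit
  inv := cls Diag.inferCounit
  hom_inv_id := cls_eq Rewrites.inferUnit_counit
  inv_hom_id := cls_eq Rewrites.inferCounit_unit

variable {X Y Z X' Y' : FinSys.{u}}

theorem inc_one : inc (SubStoch.one X) = 𝟙 _ := cls_eq (Rewrites.incl_one X)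

theorem inc_comp (S : SubStoch X Y) (T : SubStoch Y Z) : inc (S.comp T) = inc S ≫ inc T :=
  cls_eq (Rewrites.incl_comp S T)

theorem inc_tensor (S : SubStoch X Y) (T : SubStoch X' Y') :
    (inferProd X X').hom ≫ inc (S.tensor T) = (inc S ⊗ₘ inc T) ≫ (inferProd Y Y').hom :=
  cls_eq (Rewrites.incl_tensor S T)

theorem det_id : det (fun x : X => x) = 𝟙 _ := inc_one

theorem det_comp (f : X → Y) (g : Y → Z) : det f ≫ det g = det fun x => g (f x) := by
  rw [det, det, ← inc_comp, SubStoch.ofFun_comp]; rfl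

theorem det_tensor (f : X → Y) (g : X' → Y') :
    (det f ⊗ₘ det g) ≫ (inferProd Y Y').hom =
      (inferProd X X').hom ≫ det (X := X.prod X') (Y := Y.prod Y') fun p => (f p.1, g p.2) := by
  rw [det, det, ← inc_tensor, SubStoch.ofFun_tensor]; rfl

theorem det_assoc (X Y Z : FinSys.{u}) :
    (inferProd X Y).hom ▷ Ob.infer Z ≫ (inferProd (X.prod Y) Z).hom ≫
        det (Y := X.prod (Y.prod Z)) (fun p => (p.1.1, (p.1.2, p.2))) =
      (α_ _ _ _).hom ≫ Ob.infer X ◁ (inferProd Y Z).hom ≫ (inferProd X (Y.prod Z)).hom :=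
  cls_eq (Rewrites.incl_assoc X Y Z)

theorem det_lunit (X : FinSys.{u}) :
    inferStar.hom ▷ Ob.infer X ≫ (inferProd FinSys.star X).hom ≫ det (fun p => p.2) =
      (λ_ _).hom :=
  cls_eq (Rewrites.incl_lunit X)

theorem det_runit (X : FinSys.{u}) :
    Ob.infer X ◁ inferStar.hom ≫ (inferProd X FinSys.star).hom ≫ det (fun p => p.1) =
      (ρ_ _).hom :=
  cls_eq (Rewrites.incl_runit X)

theorem det_swap (X Y : FinSys.{u}) :
    (inferProd X Y).hom ≫ det (Y := Y.prod X) (fun p => (p.2, p.1)) =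
      (β_ _ _).hom ≫ (inferProd Y X).hom :=
  cls_eq (Rewrites.incl_swap X Y)

/-- The isomorphism of inferential wires given by a bijection. -/
def detIso (e : X ≃ Y) : Ob.infer X ≅ Ob.infer Y where
  hom := det e
  inv := det e.symm
  hom_inv_id := by simp [det_comp, det_id]
  inv_hom_id := by simp [det_comp, det_id]

/-- Arrays of inferential wires, with a merging into one wire. -/
class InferentialOb (P : Ob.{u}) where
  /-- The label of the merged wire. -/
  label (P) : FinSys.{u}
  /-- Merging into one wire. -/
  merge (P) : P ≅ Ob.infer label

open InferentialOb

instance : InferentialOb (Ob.infer X) := ⟨X, Iso.refl _⟩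

instance : InferentialOb (𝟙_ Ob.{u}) := ⟨FinSys.star, inferStar⟩

instance (P Q : Ob.{u}) [InferentialOb P] [InferentialOb Q] : InferentialOb (P ⊗ Q) :=
  ⟨(label P).prod (label Q), (merge P ⊗ᵢ merge Q) ≪≫ inferProd _ _⟩

theorem merge_infer : (merge (Ob.infer X)).hom = 𝟙 _ := rfl

theorem merge_unit : (merge (𝟙_ Ob.{u})).hom = inferStar.hom := rfl

theorem merge_tensor (P Q : Ob.{u}) [InferentialOb P] [InferentialOb Q] :
    (merge (P ⊗ Q)).hom = ((merge P).hom ⊗ₘ (merge Q).hom) ≫ (inferProd _ _).hom := rfl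

/-- Morphisms that come, up to merging, from substochastic maps. -/
class Inferential {P Q : Ob.{u}} [InferentialOb P] [InferentialOb Q] (h : P ⟶ Q) : Prop where
  exists_inc : ∃ S : SubStoch (label P) (label Q), (merge P).hom ≫ inc S = h ≫ (merge Q).hom

/-! ### Closure of inferential morphisms under composition and wiring -/

section

variable {P Q R P' Q' : Ob.{u}} [InferentialOb P] [InferentialOb Q] [InferentialOb R]
  [InferentialOb P'] [InferentialOb Q']

/-- Closure is recorded as instances so that typeclass search certifies the long inferential
composites that serve as witnesses later on. -/
instance (P : Ob.{u}) [InferentialOb P] : Inferential (𝟙 P) := ⟨_, by rw [inc_one]; simp⟩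

instance (f : P ⟶ Q) (g : Q ⟶ R) [hf : Inferential f] [hg : Inferential g] :
    Inferential (f ≫ g) := by
  obtain ⟨S, hS⟩ := hf
  obtain ⟨T, hT⟩ := hg
  exact ⟨S.comp T, by rw [inc_comp, reassoc_of% hS, hT, Category.assoc]⟩

instance (f : P ⟶ Q) (g : P' ⟶ Q') [hf : Inferential f] [hg : Inferential g] :
    Inferential (f ⊗ₘ g) := by
  obtain ⟨S, hS⟩ := hf
  obtain ⟨T, hT⟩ := hg
  refine ⟨S.tensor T, ?_⟩
  rw [merge_tensor, merge_tensor, Category.assoc, inc_tensor, tensorHom_comp_tensorHom_assoc,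
    tensorHom_comp_tensorHom_assoc, hS, hT]

instance (P : Ob.{u}) [InferentialOb P] (g : P' ⟶ Q') [Inferential g] :
    Inferential (P ◁ g) := by
  rw [← id_tensorHom]; infer_instance

instance (g : P' ⟶ Q') [Inferential g] (P : Ob.{u}) [InferentialOb P] :
    Inferential (g ▷ P) := by
  rw [← tensorHom_id]; infer_instance

/-- A structural isomorphism becomes a relabelling once the wires are merged, and the inverse
relabelling then handles its inverse. This settles unitors, associators and the merging isomorphisms
in both directions at once. -/
theorem inferential_of_equiv (f : P ≅ Q) (e : label P ≃ label Q)
    (h : (merge P).hom ≫ det e = f.hom ≫ (merge Q).hom) :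
    Inferential f.hom ∧ Inferential f.inv := by
  refine ⟨⟨_, h⟩, SubStoch.ofFun e.symm, ?_⟩
  have h' : (merge P).hom ≫ (detIso e).hom = f.hom ≫ (merge Q).hom := h
  change (merge Q).hom ≫ (detIso e).inv = _
  rw [Iso.comp_inv_eq, Category.assoc, h', Iso.inv_hom_id_assoc]

theorem inferential_associator (P Q R : Ob.{u}) [InferentialOb P] [InferentialOb Q]
    [InferentialOb R] : Inferential (α_ P Q R).hom ∧ Inferential (α_ P Q R).inv := by
  refine inferential_of_equiv _ (Equiv.prodAssoc _ _ _) ?_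
  have h := det_assoc (label P) (label Q) (label R)
  simp only [merge_tensor]
  have h1 : ((((merge P).hom ⊗ₘ (merge Q).hom) ≫ (inferProd _ _).hom) ⊗ₘ (merge R).hom) =
    (((merge P).hom ⊗ₘ (merge Q).hom) ⊗ₘ (merge R).hom) ≫ (inferProd _ _).hom ▷ _ := by
    rw [← tensorHom_id, tensorHom_comp_tensorHom, Category.comp_id]
  have h2 : ((merge P).hom ⊗ₘ (((merge Q).hom ⊗ₘ (merge R).hom) ≫ (inferProd _ _).hom)) =
    ((merge P).hom ⊗ₘ ((merge Q).hom ⊗ₘ (merge R).hom)) ≫ _ ◁ (inferProd _ _).hom := by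
    rw [← id_tensorHom, tensorHom_comp_tensorHom, Category.comp_id]
  rw [h1, h2]
  simp only [Category.assoc]
  refine (congrArg (_ ≫ ·) h).trans ?_
  simp only [associator_naturality_assoc]
  rfl

theorem inferential_leftUnitor (P : Ob.{u}) [InferentialOb P] :
    Inferential (λ_ P).hom ∧ Inferential (λ_ P).inv := by
  refine inferential_of_equiv _ (Equiv.punitProd _) ?_
  have h := det_lunit (label P)
  rw [merge_tensor, merge_unit, tensorHom_def', Category.assoc, Category.assoc]
  refine (congrArg (_ ≫ ·) h).trans ?_
  simp

theorem inferential_rightUnitor (P : Ob.{u}) [InferentialOb P] :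
    Inferential (ρ_ P).hom ∧ Inferential (ρ_ P).inv := by
  refine inferential_of_equiv _ (Equiv.prodPUnit _) ?_
  have h := det_runit (label P)
  rw [merge_tensor, merge_unit, MonoidalCategory.tensorHom_def, Category.assoc, Category.assoc]
  refine (congrArg (_ ≫ ·) h).trans ?_
  simp

theorem inferential_inferProd (X Y : FinSys.{u}) :
    Inferential (inferProd X Y).hom ∧ Inferential (inferProd X Y).inv := by
  refine inferential_of_equiv _ (Equiv.refl _) ?_
  change _ ≫ det (fun x => x) = _
  rw [det_id, merge_tensor, merge_infer, merge_infer, merge_infer]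
  simp
  rfl

theorem inferential_inferStar :
    Inferential inferStar.{u}.hom ∧ Inferential inferStar.{u}.inv := by
  refine inferential_of_equiv _ (Equiv.refl _) ?_
  change _ ≫ det (fun x => x) = _
  rw [det_id, merge_unit, merge_infer]
  rfl

instance : Inferential (α_ P Q R).hom := (inferential_associator P Q R).1

instance : Inferential (α_ P Q R).inv := (inferential_associator P Q R).2

instance : Inferential (λ_ P).hom := (inferential_leftUnitor P).1

instance : Inferential (λ_ P).inv := (inferential_leftUnitor P).2

instance : Inferential (ρ_ P).hom := (inferential_rightUnitor P).1

instance : Inferential (ρ_ P).inv := (inferential_rightUnitor P).2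

instance : Inferential (inferProd X Y).hom := (inferential_inferProd X Y).1

instance : Inferential (inferProd X Y).inv := (inferential_inferProd X Y).2

instance : Inferential inferStar.{u}.hom := inferential_inferStar.1

instance : Inferential inferStar.{u}.inv := inferential_inferStar.2

instance : Inferential (β_ P Q).hom :=
  ⟨SubStoch.swap _ _, by
    have h := det_swap (label P) (label Q)
    rw [merge_tensor, Category.assoc]
    refine (congrArg (_ ≫ ·) h).trans ?_
    rw [merge_tensor, BraidedCategory.braiding_naturality_assoc]⟩

instance (S : SubStoch X Y) : Inferential (inc S) := ⟨S, by simp [merge_infer]⟩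

instance (f : X → Y) : Inferential (det f) := inferInstanceAs (Inferential (inc _))

end

/-- For single wires the merging isomorphisms are identities, so nothing is left but the
substochastic map. -/
theorem exists_inc_of_inferential (h : Ob.infer X ⟶ Ob.infer Y) [hh : Inferential h] :
    ∃ S : SubStoch X Y, h = inc S := by
  obtain ⟨S, hS⟩ := hh
  refine ⟨S, ?_⟩
  rw [merge_infer, merge_infer, Category.id_comp, Category.comp_id] at hS
  exact hS.symm

/-! ## Causal diagrams and interactions -/

/-- The class of a state of knowledge. -/
def knowHom (A B : FinSys.{u}) : Ob.causal A ⊗ Ob.infer (A.fn B) ⟶ Ob.causal B :=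
  cls (Diag.know A B)

/-- The class of a question. -/
def askHom (A : FinSys.{u}) : Ob.causal A ⟶ Ob.causal A ⊗ Ob.infer A := cls (Diag.ask A)

/-- The class of ignoring. -/
def ignoreHom (A : FinSys.{u}) : Ob.causal A ⟶ 𝟙_ Ob.{u} := cls (Diag.ignore A)

/-- The class of an embedded function. -/
def func {A B : FinSys.{u}} (f : A → B) : Ob.causal A ⟶ Ob.causal B := cls (Diag.embed f)

/-- Two causal wires as one. -/
def causalProd (A B : FinSys.{u}) : Ob.causal A ⊗ Ob.causal B ≅ Ob.causal (A.prod B) where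
  hom := cls (Diag.causalMerge A B)
  inv := cls (Diag.causalSplit A B)
  hom_inv_id := cls_eq (Rewrites.causalMerge_split A B)
  inv_hom_id := cls_eq (Rewrites.causalSplit_merge A B)

/-- No wire as a causal wire. -/
def causalStar : 𝟙_ Ob.{u} ≅ Ob.causal FinSys.star.{u} where
  hom := cls Diag.causalUnit
  inv := cls Diag.causalCounit
  hom_inv_id := cls_eq Rewrites.causalUnit_counit
  inv_hom_id := cls_eq Rewrites.causalCounit_unit

/-- The point distribution, with no input wire. -/
def pt {X : FinSys.{u}} (x : X) : 𝟙_ Ob.{u} ⟶ Ob.infer X := inferStar.hom ≫ det fun _ => x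

/-- Broadcasting, with two output wires. -/
def dup (X : FinSys.{u}) : Ob.infer X ⟶ Ob.infer X ⊗ Ob.infer X :=
  det (Y := X.prod X) (fun x => (x, x)) ≫ (inferProd X X).inv

/-- Marginalisation, with no output wire. -/
def del (X : FinSys.{u}) : Ob.infer X ⟶ 𝟙_ Ob.{u} :=
  det (Y := FinSys.star) (fun _ => PUnit.unit) ≫ inferStar.inv

instance {X : FinSys.{u}} (x : X) : Inferential (pt x) := inferInstanceAs (Inferential (_ ≫ _))

instance (X : FinSys.{u}) : Inferential (dup X) := inferInstanceAs (Inferential (_ ≫ _))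

instance (X : FinSys.{u}) : Inferential (del X) := inferInstanceAs (Inferential (_ ≫ _))

/-- Composition of known functions. -/
def seqHom (A B C : FinSys.{u}) : Ob.infer (A.fn B) ⊗ Ob.infer (B.fn C) ⟶ Ob.infer (A.fn C) :=
  (inferProd _ _).hom ≫ inc (SubStoch.seqComp A B C)

/-- Parallel composition of known functions. -/
def parHom (A B A' B' : FinSys.{u}) :
    Ob.infer (A.fn B) ⊗ Ob.infer (A'.fn B') ⟶ Ob.infer ((A.prod A').fn (B.prod B')) :=
  (inferProd _ _).hom ≫ inc (SubStoch.parComp A B A' B')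

/-- Application of a known function. -/
def applyHom (A B : FinSys.{u}) : Ob.infer A ⊗ Ob.infer (A.fn B) ⟶ Ob.infer B :=
  (inferProd _ _).hom ≫ inc (SubStoch.apply A B)

instance (A B C : FinSys.{u}) : Inferential (seqHom A B C) :=
  inferInstanceAs (Inferential (_ ≫ _))

instance (A B A' B' : FinSys.{u}) : Inferential (parHom A B A' B') :=
  inferInstanceAs (Inferential (_ ≫ _))

instance (A B : FinSys.{u}) : Inferential (applyHom A B) :=
  inferInstanceAs (Inferential (_ ≫ _))

theorem func_eq {A B : FinSys.{u}} (f : A → B) :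
    func f = (ρ_ _).inv ≫ Ob.causal A ◁ pt (X := A.fn B) f ≫ knowHom A B := rfl

theorem func_id (A : FinSys.{u}) : func (fun x : A => x) = 𝟙 _ := cls_eq (Rewrites.embed_id A)

theorem func_assoc (A B C : FinSys.{u}) :
    (causalProd A B).hom ▷ Ob.causal C ≫ (causalProd (A.prod B) C).hom ≫
        func (B := A.prod (B.prod C)) (fun p => (p.1.1, (p.1.2, p.2))) =
      (α_ _ _ _).hom ≫ Ob.causal A ◁ (causalProd B C).hom ≫ (causalProd A (B.prod C)).hom :=
  cls_eq (Rewrites.embed_assoc A B C)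

theorem func_lunit (A : FinSys.{u}) :
    causalStar.hom ▷ Ob.causal A ≫ (causalProd FinSys.star A).hom ≫ func (fun p => p.2) =
      (λ_ _).hom :=
  cls_eq (Rewrites.embed_lunit A)

theorem func_runit (A : FinSys.{u}) :
    Ob.causal A ◁ causalStar.hom ≫ (causalProd A FinSys.star).hom ≫ func (fun p => p.1) =
      (ρ_ _).hom :=
  cls_eq (Rewrites.embed_runit A)

theorem func_swap (A B : FinSys.{u}) :
    (causalProd A B).hom ≫ func (B := B.prod A) (fun p => (p.2, p.1)) =
      (β_ _ _).hom ≫ (causalProd B A).hom :=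
  cls_eq (Rewrites.embed_swap A B)

theorem know_seq (A B C : FinSys.{u}) :
    knowHom A B ▷ Ob.infer (B.fn C) ≫ knowHom B C =
      (α_ _ _ _).hom ≫ Ob.causal A ◁ seqHom A B C ≫ knowHom A C :=
  cls_eq (Rewrites.know_seq A B C)

theorem know_par (A B A' B' : FinSys.{u}) :
    (knowHom A B ⊗ₘ knowHom A' B') ≫ (causalProd B B').hom =
      tensorμ _ _ _ _ ≫ ((causalProd A A').hom ⊗ₘ parHom A B A' B') ≫
        knowHom (A.prod A') (B.prod B') := by
  rw [← cls_mid]; exact cls_eq (Rewrites.know_par A B A' B')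

theorem ask_discard (A : FinSys.{u}) :
    askHom A ≫ Ob.causal A ◁ del A ≫ (ρ_ _).hom = 𝟙 _ :=
  cls_eq (Rewrites.ask_discard A)

theorem ask_ask (A : FinSys.{u}) :
    askHom A ≫ askHom A ▷ _ ≫ (α_ _ _ _).hom = askHom A ≫ Ob.causal A ◁ dup A :=
  cls_eq (Rewrites.ask_ask A)

theorem ask_par (A B : FinSys.{u}) :
    (causalProd A B).hom ≫ askHom (A.prod B) =
      (askHom A ⊗ₘ askHom B) ≫ tensorμ _ _ _ _ ≫
        ((causalProd A B).hom ⊗ₘ (inferProd A B).hom) := by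
  rw [← cls_mid]; exact cls_eq (Rewrites.ask_par A B)

theorem ignore_star : ignoreHom FinSys.star.{u} = causalStar.inv := cls_eq Rewrites.ignore_star

theorem ignore_know (A B : FinSys.{u}) :
    knowHom A B ≫ ignoreHom B = (ignoreHom A ⊗ₘ del (A.fn B)) ≫ (λ_ _).hom :=
  cls_eq (Rewrites.ignore_know A B)

/-- Propagation of knowledge, on the inferential wires. -/
def propagate (A B : FinSys.{u}) :
    Ob.infer A ⊗ Ob.infer (A.fn B) ⟶ Ob.infer (A.fn B) ⊗ Ob.infer B :=
  Ob.infer A ◁ dup (A.fn B) ≫ (α_ _ _ _).inv ≫ (β_ _ _).hom ▷ _ ≫ (α_ _ _ _).hom ≫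
    Ob.infer (A.fn B) ◁ applyHom A B

instance (A B : FinSys.{u}) : Inferential (propagate A B) :=
  inferInstanceAs (Inferential (_ ≫ _ ≫ _ ≫ _ ≫ _))

/-- The propagation rule rearranged so that all inferential processing is one morphism to the right
of the causal wire, between an `ask` and a `know`. This is the shape that composition of normal
forms needs. -/
theorem know_ask (A B : FinSys.{u}) :
    knowHom A B ≫ askHom B =
      askHom A ▷ _ ≫ (α_ _ _ _).hom ≫ Ob.causal A ◁ propagate A B ≫ (α_ _ _ _).inv ≫
        knowHom A B ▷ _ := by
  have h : knowHom A B ≫ askHom B =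
      (askHom A ⊗ₘ dup (A.fn B)) ≫ tensorμ _ _ _ _ ≫ (knowHom A B ⊗ₘ applyHom A B) := by
    rw [← cls_mid]; exact cls_eq (Rewrites.know_ask A B)
  rw [h, MonoidalCategory.tensorHom_def, tensorHom_def', tensorμ, propagate]
  monoidal

/-! ### Asking and knowing in the presence of further wires -/

section

variable (A B : FinSys.{u}) (P : Ob.{u})

/-- Asking, in the presence of other wires on the right. -/
def askOn : Ob.causal A ⊗ P ⟶ Ob.causal A ⊗ (Ob.infer A ⊗ P) := askHom A ▷ P ≫ (α_ _ _ _).hom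

/-- Knowing, in the presence of other wires on the right. -/
def knowOn : Ob.causal A ⊗ (Ob.infer (A.fn B) ⊗ P) ⟶ Ob.causal B ⊗ P :=
  (α_ _ _ _).inv ≫ knowHom A B ▷ P

variable {P} in
theorem askOn_natural {Q : Ob.{u}} (h : P ⟶ Q) :
    Ob.causal A ◁ h ≫ askOn A Q = askOn A P ≫ Ob.causal A ◁ Ob.infer A ◁ h := by
  rw [askOn, askOn, whisker_exchange_assoc]; monoidal

variable {P} in
theorem knowOn_natural {Q : Ob.{u}} (h : P ⟶ Q) :
    knowOn A B P ≫ Ob.causal B ◁ h = Ob.causal A ◁ Ob.infer (A.fn B) ◁ h ≫ knowOn A B Q := by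
  rw [knowOn, knowOn, Category.assoc, ← whisker_exchange]; monoidal

theorem askOn_askOn :
    askOn A P ≫ askOn A _ = askOn A P ≫ Ob.causal A ◁ (dup A ▷ P ≫ (α_ _ _ _).hom) := by
  simp only [askOn]
  calc _ = (askHom A ≫ askHom A ▷ _ ≫ (α_ _ _ _).hom) ▷ P ⊗≫ 𝟙 _ := by monoidal
    _ = _ := by rw [ask_ask]; monoidal

theorem knowOn_knowOn (C : FinSys.{u}) :
    knowOn A B (Ob.infer (B.fn C) ⊗ P) ≫ knowOn B C P =
      Ob.causal A ◁ ((α_ _ _ _).inv ≫ seqHom A B C ▷ P) ≫ knowOn A C P := by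
  simp only [knowOn]
  calc _ = 𝟙 _ ⊗≫ (knowHom A B ▷ _ ≫ knowHom B C) ▷ P := by monoidal
    _ = _ := by rw [know_seq]; monoidal

/-- This is the exchange law that puts every `ask` before every `know`. -/
theorem knowOn_askOn :
    knowOn A B P ≫ askOn B P =
      askOn A _ ≫ Ob.causal A ◁ ((α_ _ _ _).inv ≫ propagate A B ▷ P ≫ (α_ _ _ _).hom) ≫
        knowOn A B _ := by
  simp only [knowOn, askOn]
  calc _ = 𝟙 _ ⊗≫ (knowHom A B ≫ askHom B) ▷ P ⊗≫ 𝟙 _ := by monoidal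
    _ = _ := by rw [know_ask]; monoidal

theorem askOn_del :
    askOn A P ≫ Ob.causal A ◁ (del A ▷ P ≫ (λ_ _).hom) = 𝟙 _ := by
  simp only [askOn]
  calc _ = (askHom A ≫ Ob.causal A ◁ del A ≫ (ρ_ _).hom) ▷ P := by monoidal
    _ = _ := by rw [ask_discard]; monoidal

variable {A B} in
theorem func_whisker (f : A → B) :
    func f ▷ P = Ob.causal A ◁ ((λ_ _).inv ≫ pt (X := A.fn B) f ▷ P) ≫ knowOn A B P := by
  rw [func_eq, knowOn]; monoidal

/-- Evolving by the known identity function is doing nothing; this is how a missing `know` is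
supplied, as `askOn_del` supplies a missing `ask`. -/
theorem pt_knowOn :
    Ob.causal A ◁ ((λ_ _).inv ≫ pt (X := A.fn A) (fun x => x) ▷ P) ≫ knowOn A A P = 𝟙 _ := by
  rw [← func_whisker, func_id, id_whiskerRight]

end

/-! ## Normal morphisms -/

/-- Morphisms in normal form: asking, an inferential morphism, knowing. -/
def IsNormal {A B : FinSys.{u}} {P Q : Ob.{u}} [InferentialOb P] [InferentialOb Q]
    (f : Ob.causal A ⊗ P ⟶ Ob.causal B ⊗ Q) : Prop :=
  ∃ h : Ob.infer A ⊗ P ⟶ Ob.infer (A.fn B) ⊗ Q, Inferential h ∧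
    f = askOn A P ≫ Ob.causal A ◁ h ≫ knowOn A B Q

namespace IsNormal

variable {A B C : FinSys.{u}} {P Q R : Ob.{u}} [InferentialOb P] [InferentialOb Q]
  [InferentialOb R]

theorem comp {f : Ob.causal A ⊗ P ⟶ Ob.causal B ⊗ Q} {g : Ob.causal B ⊗ Q ⟶ Ob.causal C ⊗ R}
    (hf : IsNormal f) (hg : IsNormal g) : IsNormal (f ≫ g) := by
  obtain ⟨h, hh, rfl⟩ := hf
  obtain ⟨k, hk, rfl⟩ := hg
  -- The new inferential part: copy the answer about `A`, run `h` on one copy, use the other copy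
  -- and the function produced by `h` to compute the answer about `B`, run `k` on that answer, and
  -- compose the two functions.
  refine ⟨(dup A ▷ P ≫ (α_ _ _ _).hom) ≫ Ob.infer A ◁ h ≫
    ((α_ _ _ _).inv ≫ propagate A B ▷ Q ≫ (α_ _ _ _).hom) ≫ Ob.infer (A.fn B) ◁ k ≫
    ((α_ _ _ _).inv ≫ seqHom A B C ▷ R), inferInstance, ?_⟩
  have e1 := askOn_askOn A P
  have e2 := knowOn_knowOn A B R C
  have e3 := knowOn_askOn A B Q
  have e4 := askOn_natural A h
  have e5 := knowOn_natural A B k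
  simp only [Category.assoc]
  -- Exchange the inner `know` and `ask`, slide the `ask` left past `h` and the `know` right past
  -- `k`, then fuse the two knows and the two asks.
  rw [reassoc_of% e3, reassoc_of% e4, reassoc_of% e5, e2, reassoc_of% e1]
  simp only [MonoidalCategory.whiskerLeft_comp, Category.assoc]

theorem ask_comp (h : Ob.infer A ⊗ P ⟶ Q) [Inferential h] :
    IsNormal (askOn A P ≫ Ob.causal A ◁ h) :=
  ⟨h ≫ (λ_ _).inv ≫ pt (X := A.fn A) (fun x => x) ▷ _, inferInstance, by
    rw [MonoidalCategory.whiskerLeft_comp, Category.assoc, pt_knowOn, Category.comp_id]⟩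

theorem comp_know (h : P ⟶ Ob.infer (A.fn B) ⊗ Q) [Inferential h] :
    IsNormal (Ob.causal A ◁ h ≫ knowOn A B Q) := by
  refine ⟨(del A ▷ P ≫ (λ_ _).hom) ≫ h, inferInstance, ?_⟩
  rw [MonoidalCategory.whiskerLeft_comp, Category.assoc, reassoc_of% (askOn_del A P)]

theorem whiskerLeft (h : P ⟶ Q) [Inferential h] : IsNormal (Ob.causal A ◁ h) := by
  -- Ask, discard the answer, then run `h`.
  have := ask_comp (A := A) (del A ▷ P ≫ (λ_ _).hom ≫ h)
  have e := askOn_del A P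
  simp only [MonoidalCategory.whiskerLeft_comp] at this e
  rwa [← Category.assoc, ← Category.assoc, Category.assoc (askOn A P), e, Category.id_comp] at this

theorem id : IsNormal (𝟙 (Ob.causal A ⊗ P)) := by
  rw [← MonoidalCategory.whiskerLeft_id]; exact whiskerLeft _

theorem func_whiskerRight (f : A → B) : IsNormal (func f ▷ P) := by
  rw [func_whisker]; exact comp_know _

theorem func_tensor (f : A → B) (h : P ⟶ Q) [Inferential h] : IsNormal (func f ⊗ₘ h) := by
  rw [MonoidalCategory.tensorHom_def]; exact (func_whiskerRight f).comp (whiskerLeft h)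

end IsNormal

/-! ### The middle exchange in a symmetric monoidal category -/

section

variable {C : Type*} [Category* C] [MonoidalCategory C] [SymmetricCategory C]

theorem rightUnitor_inv_tensorμ (X Y Z : C) :
    (ρ_ X).inv ▷ (Y ⊗ Z) ≫ tensorμ X (𝟙_ C) Y Z = (α_ X Y Z).inv ≫ (X ⊗ Y) ◁ (λ_ Z).inv := by
  rw [tensorμ, braiding_tensorUnit_left]
  monoidal

theorem leftUnitor_hom_tensorμ (X Y Z : C) :
    tensorμ X (𝟙_ C) Y Z ≫ (X ⊗ Y) ◁ (λ_ Z).hom = (ρ_ X).hom ▷ (Y ⊗ Z) ≫ (α_ X Y Z).inv := by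
  rw [tensorμ, braiding_tensorUnit_left]
  monoidal

theorem tensorμ_tensorμ (X₁ X₂ Y₁ Y₂ : C) :
    tensorμ X₁ X₂ Y₁ Y₂ ≫ tensorμ X₁ Y₁ X₂ Y₂ = 𝟙 _ := by
  have h : tensorμ X₁ Y₁ X₂ Y₂ = tensorδ X₁ X₂ Y₁ Y₂ := by
    rw [tensorμ, tensorδ, SymmetricCategory.braiding_swap_eq_inv_braiding]
  rw [h, tensorμ_tensorδ]

/-- Exchange of the two middle objects among four. -/
def middleExchange (X₁ X₂ Y₁ Y₂ : C) : (X₁ ⊗ X₂) ⊗ (Y₁ ⊗ Y₂) ≅ (X₁ ⊗ Y₁) ⊗ (X₂ ⊗ Y₂) where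
  hom := tensorμ X₁ X₂ Y₁ Y₂
  inv := tensorμ X₁ Y₁ X₂ Y₂
  hom_inv_id := tensorμ_tensorμ X₁ X₂ Y₁ Y₂
  inv_hom_id := tensorμ_tensorμ X₁ Y₁ X₂ Y₂

theorem tensorμ_braiding (X₁ X₂ Y₁ Y₂ : C) :
    tensorμ X₁ X₂ Y₁ Y₂ ≫ ((β_ X₁ Y₁).hom ⊗ₘ (β_ X₂ Y₂).hom) =
      (β_ (X₁ ⊗ X₂) (Y₁ ⊗ Y₂)).hom ≫ tensorμ Y₁ Y₂ X₁ X₂ := by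
  simp [tensorμ, SymmetricCategory.braiding_swap_eq_inv_braiding Y₂ X₁,
    MonoidalCategory.tensorHom_def]

/-- Move `X₂` past the whole of `Y₁ ⊗ Y₂`, then bring it back past `Y₂`. In this form naturality of
the braiding applies to a morphism that does not split along `Y₁ ⊗ Y₂`. -/
theorem tensorμ_eq_crossing (X₁ X₂ Y₁ Y₂ : C) :
    tensorμ X₁ X₂ Y₁ Y₂ = (α_ _ _ _).hom ≫
      X₁ ◁ ((β_ X₂ (Y₁ ⊗ Y₂)).hom ≫ (α_ _ _ _).hom ≫ Y₁ ◁ (β_ Y₂ X₂).hom) ≫ (α_ _ _ _).inv := by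
  have h : Y₁ ◁ (β_ X₂ Y₂).hom ≫ Y₁ ◁ (β_ Y₂ X₂).hom = 𝟙 _ := by
    rw [← MonoidalCategory.whiskerLeft_comp, SymmetricCategory.symmetry,
      MonoidalCategory.whiskerLeft_id]
  rw [tensorμ, BraidedCategory.braiding_tensor_right_hom]
  simp [h]

end

/-! ### Functoriality of the embedding of functions -/

theorem inferStar_inferProd {X : FinSys.{u}} (x : X) :
    (λ_ (𝟙_ Ob.{u})).inv ≫ (inferStar.hom ⊗ₘ inferStar.hom) ≫ (inferProd _ _).hom ≫
      det (fun _ => x) = pt x := by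
  -- Factoring the constant map through the second projection brings in the left unit rule.
  have h : det (X := FinSys.star.prod FinSys.star) (fun _ => x) =
      det (X := FinSys.star.prod FinSys.star) (Y := FinSys.star) (fun p => p.2) ≫
        det (fun _ => x) := by rw [det_comp]
  have h' := det_lunit FinSys.star.{u}
  rw [h, tensorHom_def']
  simp only [Category.assoc]
  rw [reassoc_of% h', leftUnitor_naturality_assoc, Iso.inv_hom_id_assoc]
  rfl

theorem pt_seqHom {A B C : FinSys.{u}} (f : A → B) (g : B → C) :
    (λ_ (𝟙_ Ob.{u})).inv ≫ (pt (X := A.fn B) f ⊗ₘ pt (X := B.fn C) g) ≫ seqHom A B C =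
      pt (X := A.fn C) fun a => g (f a) := by
  have h := det_tensor (X := FinSys.star) (X' := FinSys.star) (Y := A.fn B) (Y' := B.fn C)
    (fun _ => f) (fun _ => g)
  rw [pt, pt, seqHom, ← tensorHom_comp_tensorHom]
  simp only [Category.assoc]
  rw [reassoc_of% h]
  change (λ_ _).inv ≫ _ ≫ _ ≫ det _ ≫ det _ = _
  rw [det_comp, inferStar_inferProd]

/-- The rules give preservation of composition only through `know`: two point distributions on
functions compose to the point distribution on the composite. The result makes bijections of labels
into isomorphisms of causal wires. -/
theorem func_comp {A B C : FinSys.{u}} (f : A → B) (g : B → C) :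
    func f ≫ func g = func fun a => g (f a) := by
  rw [func_eq f, func_eq g, func_eq, ← pt_seqHom f g]
  calc _ = 𝟙 _ ⊗≫ Ob.causal A ◁ pt (X := A.fn B) f ⊗≫
        (knowHom A B ▷ 𝟙_ Ob ≫ Ob.causal B ◁ pt (X := B.fn C) g) ≫ knowHom B C := by monoidal
    -- By interchange, the second function may be supplied before the first `know` acts, so that
    -- `know_seq` applies.
    _ = 𝟙 _ ⊗≫ Ob.causal A ◁ (pt (X := A.fn B) f ▷ 𝟙_ Ob ≫ _ ◁ pt (X := B.fn C) g) ⊗≫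
        knowHom A B ▷ _ ≫ knowHom B C := by
      rw [← whisker_exchange (knowHom A B)]; monoidal
    _ = _ := by rw [know_seq, ← MonoidalCategory.tensorHom_def]; monoidal

/-- The isomorphism of causal wires given by a bijection. -/
def funcIso {A B : FinSys.{u}} (e : A ≃ B) : Ob.causal A ≅ Ob.causal B where
  hom := func e
  inv := func e.symm
  hom_inv_id := by simp [func_comp, func_id]
  inv_hom_id := by simp [func_comp, func_id]

/-! ### Absorbing an idle causal wire -/

section

variable (C A B : FinSys.{u})

/-- The idle wire `C` may be asked with its answer discarded. The two questions in parallel are then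
one question about `C × A`, whose answer is marginalised over `C`. -/
theorem whiskerLeft_ask :
    Ob.causal C ◁ askHom A ≫ (α_ _ _ _).inv ≫ (causalProd C A).hom ▷ _ =
      (causalProd C A).hom ≫ askHom (C.prod A) ≫
        _ ◁ ((inferProd C A).inv ≫ del C ▷ _ ≫ (λ_ _).hom) := by
  have h := ask_par C A
  have h1 := tensorμ_natural (𝟙 (Ob.causal C)) (del C) (𝟙 (Ob.causal A)) (𝟙 (Ob.infer A))
  have h2 := leftUnitor_hom_tensorμ (Ob.causal C) (Ob.causal A) (Ob.infer A)
  have h3 := ask_discard C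
  have h1' : (Ob.causal C ◁ del C) ▷ (Ob.causal A ⊗ Ob.infer A) ≫ tensorμ _ _ _ _ =
    tensorμ _ _ _ _ ≫ _ ◁ (del C ▷ _) := by simpa using h1
  have h4 : ((causalProd C A).hom ⊗ₘ (inferProd C A).hom) ≫
      _ ◁ ((inferProd C A).inv ≫ del C ▷ _ ≫ (λ_ _).hom) =
        _ ◁ (del C ▷ _ ≫ (λ_ _).hom) ≫ (causalProd C A).hom ▷ _ := by
    rw [MonoidalCategory.tensorHom_def, Category.assoc, ← MonoidalCategory.whiskerLeft_comp,
      Iso.hom_inv_id_assoc, ← whisker_exchange]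
  rw [reassoc_of% h]
  calc _ = (askHom C ≫ Ob.causal C ◁ del C ≫ (ρ_ _).hom) ▷ _ ≫ Ob.causal C ◁ askHom A ≫
        (α_ _ _ _).inv ≫ (causalProd C A).hom ▷ _ := by rw [h3]; simp
    _ = (askHom C ⊗ₘ askHom A) ≫ (Ob.causal C ◁ del C) ▷ _ ≫ (ρ_ _).hom ▷ _ ≫
        (α_ _ _ _).inv ≫ (causalProd C A).hom ▷ _ := by
      rw [MonoidalCategory.tensorHom_def]
      simp only [comp_whiskerRight, Category.assoc]
      rw [← whisker_exchange_assoc, ← whisker_exchange_assoc]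
    _ = _ := by
      rw [← reassoc_of% h2, reassoc_of% h1', h4]
      simp only [MonoidalCategory.whiskerLeft_comp, Category.assoc]

/-- The idle wire evolves by the known identity function, so `know_par` combines the two evolutions
into one on `C × A`. -/
theorem whiskerLeft_know :
    Ob.causal C ◁ knowHom A B ≫ (causalProd C B).hom =
      (α_ _ _ _).inv ≫ (causalProd C A).hom ▷ _ ≫
        _ ◁ ((λ_ _).inv ≫ pt (X := C.fn C) (fun x => x) ▷ _ ≫ parHom C C A B) ≫
          knowHom (C.prod A) (C.prod B) := by
  have h := know_par C C A B
  have h1 := tensorμ_natural (𝟙 (Ob.causal C)) (pt (X := C.fn C) fun x => x) (𝟙 (Ob.causal A))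
    (𝟙 (Ob.infer (A.fn B)))
  have h1' : (Ob.causal C ◁ pt (X := C.fn C) fun x => x) ▷ (Ob.causal A ⊗ Ob.infer (A.fn B)) ≫
      tensorμ _ _ _ _ = tensorμ _ _ _ _ ≫ _ ◁ ((pt (X := C.fn C) fun x => x) ▷ _) := by
    simpa using h1
  have h2 := rightUnitor_inv_tensorμ (Ob.causal C) (Ob.causal A) (Ob.infer (A.fn B))
  have h3 := func_id C
  rw [func_eq] at h3
  calc _ = ((ρ_ _).inv ≫ Ob.causal C ◁ (pt (X := C.fn C) fun x => x) ≫ knowHom C C) ▷ _ ≫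
        Ob.causal C ◁ knowHom A B ≫ (causalProd C B).hom := by rw [h3]; simp
    _ = (ρ_ _).inv ▷ _ ≫ (Ob.causal C ◁ (pt (X := C.fn C) fun x => x)) ▷ _ ≫
        (knowHom C C ⊗ₘ knowHom A B) ≫ (causalProd C B).hom := by
      rw [MonoidalCategory.tensorHom_def]
      simp only [comp_whiskerRight, Category.assoc]
    _ = _ := by
      rw [h, reassoc_of% h1', reassoc_of% h2, tensorHom_def']
      simp only [MonoidalCategory.whiskerLeft_comp, Category.assoc, ← whisker_exchange_assoc]

end

namespace IsNormal

variable {A B : FinSys.{u}} {P Q : Ob.{u}} [InferentialOb P] [InferentialOb Q]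

/-- An idle inferential wire on the right simply joins the inferential part. -/
theorem tensor_right {f : Ob.causal A ⊗ P ⟶ Ob.causal B ⊗ Q} (hf : IsNormal f) (R : Ob.{u})
    [InferentialOb R] : IsNormal ((α_ _ P R).inv ≫ f ▷ R ≫ (α_ _ Q R).hom) := by
  obtain ⟨h, hh, rfl⟩ := hf
  refine ⟨(α_ _ _ _).inv ≫ h ▷ R ≫ (α_ _ _ _).hom, inferInstance, ?_⟩
  simp only [askOn, knowOn]
  monoidal

theorem tensor_left_causal {f : Ob.causal A ⊗ P ⟶ Ob.causal B ⊗ Q} (hf : IsNormal f)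
    (C : FinSys.{u}) :
    ∃ g : Ob.causal (C.prod A) ⊗ P ⟶ Ob.causal (C.prod B) ⊗ Q, IsNormal g ∧
      Ob.causal C ◁ f ≫ (α_ _ _ _).inv ≫ (causalProd C B).hom ▷ Q =
        (α_ _ _ _).inv ≫ (causalProd C A).hom ▷ P ≫ g := by
  obtain ⟨h, hh, rfl⟩ := hf
  refine ⟨(askOn _ P ≫ _ ◁ (((inferProd C A).inv ≫ del C ▷ _ ≫ (λ_ _).hom) ▷ P)) ≫
      _ ◁ h ≫ _ ◁ (((λ_ _).inv ≫ pt (X := C.fn C) (fun x => x) ▷ _ ≫ parHom C C A B) ▷ Q) ≫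
      knowOn _ _ Q, (ask_comp _).comp ((whiskerLeft h).comp (comp_know _)), ?_⟩
  have h1 : Ob.causal C ◁ askOn A P ≫ (α_ _ _ _).inv ≫ (causalProd C A).hom ▷ _ =
      (α_ _ _ _).inv ≫ (causalProd C A).hom ▷ P ≫ askOn _ P ≫
        _ ◁ (((inferProd C A).inv ≫ del C ▷ _ ≫ (λ_ _).hom) ▷ P) := by
    simp only [askOn]
    calc _ = 𝟙 _ ⊗≫ (Ob.causal C ◁ askHom A ≫ (α_ _ _ _).inv ≫ (causalProd C A).hom ▷ _) ▷ P ⊗≫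
          𝟙 _ := by monoidal
      _ = _ := by rw [whiskerLeft_ask]; monoidal
  have h2 : Ob.causal C ◁ knowOn A B Q ≫ (α_ _ _ _).inv ≫ (causalProd C B).hom ▷ Q =
      (α_ _ _ _).inv ≫ (causalProd C A).hom ▷ _ ≫
        _ ◁ (((λ_ _).inv ≫ pt (X := C.fn C) (fun x => x) ▷ _ ≫ parHom C C A B) ▷ Q) ≫
          knowOn _ _ Q := by
    simp only [knowOn]
    calc _ = 𝟙 _ ⊗≫ (Ob.causal C ◁ knowHom A B ≫ (causalProd C B).hom) ▷ Q ⊗≫ 𝟙 _ := by monoidal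
      _ = _ := by rw [whiskerLeft_know]; monoidal
  have h3 : Ob.causal C ◁ Ob.causal A ◁ h ≫ (α_ _ _ _).inv ≫ (causalProd C A).hom ▷ _ =
      (α_ _ _ _).inv ≫ (causalProd C A).hom ▷ _ ≫ _ ◁ h := by
    rw [← whisker_exchange]; monoidal
  simp only [MonoidalCategory.whiskerLeft_comp, Category.assoc] at h1 h2 ⊢
  rw [h2, reassoc_of% h3, reassoc_of% h1]

theorem tensor_left {f : Ob.causal A ⊗ P ⟶ Ob.causal B ⊗ Q} (hf : IsNormal f)
    (C : FinSys.{u}) (R : Ob.{u}) [InferentialOb R] :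
    ∃ g : Ob.causal (C.prod A) ⊗ (R ⊗ P) ⟶ Ob.causal (C.prod B) ⊗ (R ⊗ Q), IsNormal g ∧
      (Ob.causal C ⊗ R) ◁ f ≫ tensorμ _ _ _ _ ≫ (causalProd C B).hom ▷ (R ⊗ Q) =
        tensorμ _ _ _ _ ≫ (causalProd C A).hom ▷ (R ⊗ P) ≫ g := by
  -- The idle inferential wire `R` lies to the left of `P`: cross it to the right, where it is
  -- absorbed by `tensor_right`, and cross it back. The idle causal wire `C` is dealt with
  -- afterwards.
  have hk : IsNormal (Ob.causal A ◁ (β_ R P).hom ≫ ((α_ _ P R).inv ≫ f ▷ R ≫ (α_ _ Q R).hom) ≫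
      Ob.causal B ◁ (β_ Q R).hom) :=
    (whiskerLeft _).comp ((hf.tensor_right R).comp (whiskerLeft _))
  obtain ⟨g, hg, h⟩ := hk.tensor_left_causal C
  refine ⟨g, hg, ?_⟩
  rw [tensorμ_eq_crossing, tensorμ_eq_crossing]
  simp only [Category.assoc]
  rw [← h]
  simp only [← Category.assoc]
  congr 2
  simp only [Category.assoc, tensor_whiskerLeft, Iso.inv_hom_id_assoc,
    ← MonoidalCategory.whiskerLeft_comp]
  congr 2
  have h' : Ob.causal A ◁ (β_ P R).hom ≫ Ob.causal A ◁ (β_ R P).hom = 𝟙 _ := by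
    rw [← MonoidalCategory.whiskerLeft_comp, SymmetricCategory.symmetry,
      MonoidalCategory.whiskerLeft_id]
  rw [reassoc_of% h', Iso.hom_inv_id_assoc,
    BraidedCategory.braiding_naturality_right_assoc]

end IsNormal

/-! ## Gathering -/

/-- Gathering no wires. -/
def frameUnit : 𝟙_ Ob.{u} ≅ Ob.causal FinSys.star ⊗ Ob.infer FinSys.star :=
  (λ_ (𝟙_ Ob.{u})).symm ≪≫ (causalStar ⊗ᵢ inferStar)

/-- Gathering a single causal wire. -/
def frameCausal (A : FinSys.{u}) : Ob.causal A ≅ Ob.causal A ⊗ Ob.infer FinSys.star :=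
  (ρ_ (Ob.causal A)).symm ≪≫ (Iso.refl _ ⊗ᵢ inferStar)

/-- Gathering a single inferential wire. -/
def frameInfer (X : FinSys.{u}) : Ob.infer X ≅ Ob.causal FinSys.star ⊗ Ob.infer X :=
  (λ_ (Ob.infer X)).symm ≪≫ (causalStar ⊗ᵢ Iso.refl _)

/-- Gathering a pair of gathered arrays. -/
def frameTensor {a b : Ob.{u}} {A X B Y : FinSys.{u}} (g : a ≅ Ob.causal A ⊗ Ob.infer X)
    (k : b ≅ Ob.causal B ⊗ Ob.infer Y) :
    a ⊗ b ≅ Ob.causal (A.prod B) ⊗ Ob.infer (X.prod Y) :=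
  (g ⊗ᵢ k) ≪≫ middleExchange _ _ _ _ ≪≫ (causalProd A B ⊗ᵢ inferProd X Y)

theorem frameUnit_hom :
    frameUnit.{u}.hom = (λ_ (𝟙_ Ob.{u})).inv ≫ (causalStar.hom ⊗ₘ inferStar.hom) := rfl

theorem frameCausal_hom (A : FinSys.{u}) :
    (frameCausal A).hom = (ρ_ _).inv ≫ Ob.causal A ◁ inferStar.hom := by
  rw [← id_tensorHom]; rfl

theorem frameCausal_inv (A : FinSys.{u}) :
    (frameCausal A).inv = Ob.causal A ◁ inferStar.inv ≫ (ρ_ _).hom := by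
  rw [← id_tensorHom]; rfl

theorem frameInfer_hom (X : FinSys.{u}) :
    (frameInfer X).hom = (λ_ _).inv ≫ causalStar.hom ▷ Ob.infer X := by
  rw [← tensorHom_id]; rfl

/-! ### Structural wiring as functions on the two bundles -/

section

variable {a b c : Ob.{u}} {A X B Y C Z : FinSys.{u}} (g : a ≅ Ob.causal A ⊗ Ob.infer X)
  (k : b ≅ Ob.causal B ⊗ Ob.infer Y) (l : c ≅ Ob.causal C ⊗ Ob.infer Z)

theorem frameTensor_hom :
    (frameTensor g k).hom = (g.hom ⊗ₘ k.hom) ≫ tensorμ _ _ _ _ ≫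
      ((causalProd A B).hom ⊗ₘ (inferProd X Y).hom) := rfl

/-- Rebracketing pairs of bundles acts on the causal and the inferential bundles separately by
coherence of the middle exchange (`tensor_associativity`); on each bundle it is then the
rebracketing function of Cartesian products. The unitors and the braiding follow the same pattern.
-/
theorem frame_associator :
    (α_ a b c).hom ≫ (frameTensor g (frameTensor k l)).hom =
      (frameTensor (frameTensor g k) l).hom ≫
        (func (B := A.prod (B.prod C)) (fun p => (p.1.1, (p.1.2, p.2))) ⊗ₘ
          det (Y := X.prod (Y.prod Z)) (fun p => (p.1.1, (p.1.2, p.2)))) := by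
  have h1 := tensorμ_natural_left (causalProd A B).hom (inferProd X Y).hom
    (Ob.causal C) (Ob.infer Z)
  have h2 := tensorμ_natural_right (Ob.causal A) (Ob.infer X) (causalProd B C).hom
    (inferProd Y Z).hom
  have h3 := tensor_associativity (Ob.causal A) (Ob.infer X) (Ob.causal B) (Ob.infer Y)
    (Ob.causal C) (Ob.infer Z)
  have h4 : ((g.hom ⊗ₘ k.hom) ≫ tensorμ _ _ _ _ ≫
      ((causalProd A B).hom ⊗ₘ (inferProd X Y).hom)) ⊗ₘ l.hom =
        ((g.hom ⊗ₘ k.hom) ⊗ₘ l.hom) ≫ tensorμ _ _ _ _ ▷ _ ≫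
          ((causalProd A B).hom ⊗ₘ (inferProd X Y).hom) ▷ _ := by
    rw [← comp_whiskerRight, ← tensorHom_id, tensorHom_comp_tensorHom, Category.comp_id]
  have h5 : g.hom ⊗ₘ ((k.hom ⊗ₘ l.hom) ≫ tensorμ _ _ _ _ ≫
      ((causalProd B C).hom ⊗ₘ (inferProd Y Z).hom)) =
        (g.hom ⊗ₘ (k.hom ⊗ₘ l.hom)) ≫ _ ◁ tensorμ _ _ _ _ ≫
          _ ◁ ((causalProd B C).hom ⊗ₘ (inferProd Y Z).hom) := by
    rw [← MonoidalCategory.whiskerLeft_comp, ← id_tensorHom, tensorHom_comp_tensorHom,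
      Category.comp_id]
  simp only [frameTensor_hom, h4, h5, Category.assoc]
  rw [reassoc_of% h1, reassoc_of% h2, ← associator_naturality_assoc, ← reassoc_of% h3]
  simp only [tensorHom_comp_tensorHom]
  rw [func_assoc, det_assoc]

theorem frame_leftUnitor :
    (λ_ a).hom ≫ g.hom = (frameTensor frameUnit g).hom ≫
      (func (A := FinSys.star.prod A) (fun p => p.2) ⊗ₘ
        det (X := FinSys.star.prod X) (fun p => p.2)) := by
  have h1 := tensorμ_natural_left causalStar.hom inferStar.hom (Ob.causal A) (Ob.infer X)
  have h2 := tensor_left_unitality (Ob.causal A) (Ob.infer X)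
  have h3 : (frameUnit.{u}.hom ⊗ₘ g.hom) = _ ◁ g.hom ≫ (λ_ _).inv ▷ _ ≫
      (causalStar.hom ⊗ₘ inferStar.hom) ▷ _ := by
    rw [frameUnit_hom, tensorHom_def', comp_whiskerRight]
  rw [frameTensor_hom, h3]
  simp only [Category.assoc]
  rw [reassoc_of% h1]
  simp only [tensorHom_comp_tensorHom]
  rw [func_lunit, det_lunit, ← h2, leftUnitor_naturality]

theorem frame_rightUnitor :
    (ρ_ a).hom ≫ g.hom = (frameTensor g frameUnit).hom ≫
      (func (A := A.prod FinSys.star) (fun p => p.1) ⊗ₘ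
        det (X := X.prod FinSys.star) (fun p => p.1)) := by
  have h1 := tensorμ_natural_right (Ob.causal A) (Ob.infer X) causalStar.hom inferStar.hom
  have h2 := tensor_right_unitality (Ob.causal A) (Ob.infer X)
  have h3 : (g.hom ⊗ₘ frameUnit.{u}.hom) = g.hom ▷ _ ≫ _ ◁ (λ_ _).inv ≫
      _ ◁ (causalStar.hom ⊗ₘ inferStar.hom) := by
    rw [frameUnit_hom, MonoidalCategory.tensorHom_def, MonoidalCategory.whiskerLeft_comp]
  rw [frameTensor_hom, h3]
  simp only [Category.assoc]
  rw [reassoc_of% h1]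
  simp only [tensorHom_comp_tensorHom]
  rw [func_runit, det_runit, ← h2, rightUnitor_naturality]

theorem frame_braiding :
    (β_ a b).hom ≫ (frameTensor k g).hom = (frameTensor g k).hom ≫
      (func (A := A.prod B) (B := B.prod A) (fun p => (p.2, p.1)) ⊗ₘ
        det (X := X.prod Y) (Y := Y.prod X) (fun p => (p.2, p.1))) := by
  have h := tensorμ_braiding (Ob.causal A) (Ob.infer X) (Ob.causal B) (Ob.infer Y)
  simp only [frameTensor_hom, Category.assoc, tensorHom_comp_tensorHom]
  rw [func_swap, det_swap, ← BraidedCategory.braiding_naturality_assoc, ← reassoc_of% h,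
    tensorHom_comp_tensorHom]

theorem causalStar_causalStar :
    (causalStar.{u}.hom ⊗ₘ causalStar.hom) ≫ (causalProd _ _).hom ≫ func (fun p => p.2) =
      (λ_ _).hom ≫ causalStar.hom := by
  rw [tensorHom_def', Category.assoc, func_lunit, leftUnitor_naturality]

theorem inferStar_inferStar :
    (inferStar.{u}.hom ⊗ₘ inferStar.hom) ≫ (inferProd _ _).hom ≫ det (fun p => p.2) =
      (λ_ _).hom ≫ inferStar.hom := by
  rw [tensorHom_def', Category.assoc, det_lunit, leftUnitor_naturality]

/-- Gathering the two wires separately creates two trivial causal wires, and gathering the merged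
wire only one; the projection accounts for the difference. -/
theorem frame_inferProd (X Y : FinSys.{u}) :
    (inferProd X Y).hom ≫ (frameInfer (X.prod Y)).hom =
      (frameTensor (frameInfer X) (frameInfer Y)).hom ≫
        (func (A := FinSys.star.prod FinSys.star) (fun p => p.2) ⊗ₘ
          det (X := X.prod Y) (fun p => p)) := by
  have h1 := tensorμ_natural causalStar.hom (𝟙 (Ob.infer X)) causalStar.hom (𝟙 (Ob.infer Y))
  have h2 := leftUnitor_monoidal (Ob.infer X) (Ob.infer Y)
  have h3 : ((λ_ (Ob.infer X)).inv ⊗ₘ (λ_ (Ob.infer Y)).inv) ≫ tensorμ _ _ _ _ ≫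
      (λ_ _).hom ▷ _ = (λ_ _).inv := by
    rw [← cancel_mono (λ_ _).hom, Category.assoc, Category.assoc, ← h2,
      tensorHom_comp_tensorHom]
    simp
  have h4 : ((frameInfer X).hom ⊗ₘ (frameInfer Y).hom) =
      ((λ_ (Ob.infer X)).inv ⊗ₘ (λ_ (Ob.infer Y)).inv) ≫
        ((causalStar.hom ⊗ₘ 𝟙 _) ⊗ₘ (causalStar.hom ⊗ₘ 𝟙 _)) := by
    rw [tensorHom_comp_tensorHom, tensorHom_id, tensorHom_id, frameInfer_hom, frameInfer_hom]
  rw [frameTensor_hom, h4, det_id]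
  simp only [Category.assoc, reassoc_of% h1]
  simp only [tensorHom_comp_tensorHom, causalStar_causalStar, Category.comp_id, id_tensorHom_id,
    Category.id_comp]
  rw [← Category.id_comp (inferProd X Y).hom, ← tensorHom_comp_tensorHom, tensorHom_id,
    reassoc_of% h3, frameInfer_hom, tensorHom_def']
  simp

theorem frame_causalProd (A B : FinSys.{u}) :
    (causalProd A B).hom ≫ (frameCausal (A.prod B)).hom =
      (frameTensor (frameCausal A) (frameCausal B)).hom ≫
        (func (A := A.prod B) (fun p => p) ⊗ₘ
          det (X := FinSys.star.prod FinSys.star) (fun p => p.2)) := by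
  have h1 := tensorμ_natural (𝟙 (Ob.causal A)) inferStar.hom (𝟙 (Ob.causal B)) inferStar.hom
  have h2 := rightUnitor_monoidal (Ob.causal A) (Ob.causal B)
  have h3 : ((ρ_ (Ob.causal A)).inv ⊗ₘ (ρ_ (Ob.causal B)).inv) ≫ tensorμ _ _ _ _ ≫
      _ ◁ (λ_ _).hom = (ρ_ _).inv := by
    rw [← cancel_mono (ρ_ _).hom, Category.assoc, Category.assoc, ← h2,
      tensorHom_comp_tensorHom]
    simp
  have h4 : ((frameCausal A).hom ⊗ₘ (frameCausal B).hom) =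
      ((ρ_ (Ob.causal A)).inv ⊗ₘ (ρ_ (Ob.causal B)).inv) ≫
        ((𝟙 _ ⊗ₘ inferStar.hom) ⊗ₘ (𝟙 _ ⊗ₘ inferStar.hom)) := by
    rw [tensorHom_comp_tensorHom, id_tensorHom, id_tensorHom, frameCausal_hom, frameCausal_hom]
  rw [frameTensor_hom, h4, func_id]
  simp only [Category.assoc, reassoc_of% h1]
  simp only [tensorHom_comp_tensorHom, inferStar_inferStar, Category.comp_id, id_tensorHom_id,
    Category.id_comp]
  rw [← Category.id_comp (causalProd A B).hom, ← tensorHom_comp_tensorHom, id_tensorHom,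
    reassoc_of% h3, frameCausal_hom, MonoidalCategory.tensorHom_def]
  simp

theorem frame_inferStar :
    inferStar.{u}.hom ≫ (frameInfer _).hom =
      frameUnit.hom ≫ (func (fun p => p) ⊗ₘ det (fun p => p)) := by
  rw [func_id, det_id, frameInfer_hom, frameUnit_hom, tensorHom_def']
  simp

theorem frame_causalStar :
    causalStar.{u}.hom ≫ (frameCausal _).hom =
      frameUnit.hom ≫ (func (fun p => p) ⊗ₘ det (fun p => p)) := by
  rw [func_id, det_id, frameCausal_hom, frameUnit_hom, MonoidalCategory.tensorHom_def,
    unitors_inv_equal]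
  simp

/-- Gathering an array that is already one causal and one inferential wire still pads both labels
with the one-point set. These bijections remove the padding. -/
theorem frame_pair (A X : FinSys.{u}) :
    (frameTensor (frameCausal A) (frameInfer X)).hom ≫
      (funcIso (A := A.prod FinSys.star) (B := A) (Equiv.prodPUnit A) ⊗ᵢ
        detIso (X := FinSys.star.prod X) (Y := X) (Equiv.punitProd X)).hom = 𝟙 _ := by
  change _ ≫ (func (A := A.prod FinSys.star) (fun p => p.1) ⊗ₘ
    det (X := FinSys.star.prod X) (fun p => p.2)) = _
  have h1 := tensorμ_natural (𝟙 (Ob.causal A)) inferStar.hom causalStar.hom (𝟙 (Ob.infer X))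
  have h2 : tensorμ (Ob.causal A) (𝟙_ Ob) (𝟙_ Ob) (Ob.infer X) ≫ ((ρ_ _).hom ⊗ₘ (λ_ _).hom) =
      ((ρ_ _).hom ⊗ₘ (λ_ _).hom) := by
    rw [tensorμ, braiding_tensorUnit_left]
    monoidal
  have h4 : ((frameCausal A).hom ⊗ₘ (frameInfer X).hom) =
      ((ρ_ (Ob.causal A)).inv ⊗ₘ (λ_ (Ob.infer X)).inv) ≫
        ((𝟙 _ ⊗ₘ inferStar.hom) ⊗ₘ (causalStar.hom ⊗ₘ 𝟙 _)) := by
    rw [tensorHom_comp_tensorHom, id_tensorHom, tensorHom_id, frameCausal_hom, frameInfer_hom]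
  rw [frameTensor_hom, h4]
  simp only [Category.assoc, reassoc_of% h1]
  simp only [tensorHom_comp_tensorHom, tensorHom_id, id_tensorHom]
  rw [func_runit, det_lunit, h2, tensorHom_comp_tensorHom]
  simp

end

/-! ### Normality relative to gatherings -/

/-- Morphisms that are normal after gathering the source along `g` and the target along `k`. -/
def NormalVia {a b : Ob.{u}} {A X B Y : FinSys.{u}} (g : a ≅ Ob.causal A ⊗ Ob.infer X)
    (k : b ≅ Ob.causal B ⊗ Ob.infer Y) (f : a ⟶ b) : Prop :=
  IsNormal (g.inv ≫ f ≫ k.hom)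

namespace NormalVia

variable {a b c : Ob.{u}} {A X B Y C Z : FinSys.{u}} {g : a ≅ Ob.causal A ⊗ Ob.infer X}
  {k : b ≅ Ob.causal B ⊗ Ob.infer Y} {l : c ≅ Ob.causal C ⊗ Ob.infer Z}

theorem id (g : a ≅ Ob.causal A ⊗ Ob.infer X) : NormalVia g g (𝟙 a) := by
  rw [NormalVia, Category.id_comp, Iso.inv_hom_id]
  exact IsNormal.id

theorem comp {f : a ⟶ b} {f' : b ⟶ c} (hf : NormalVia g k f) (hf' : NormalVia k l f') :
    NormalVia g l (f ≫ f') := by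
  have := IsNormal.comp hf hf'
  simpa only [NormalVia, Category.assoc, Iso.hom_inv_id_assoc] using this

/-- Reduces each structural isomorphism, together with its inverse, to bijections on the two
bundles. -/
theorem of_equiv (f : a ≅ b) (e : A ≃ B) (e' : X ≃ Y)
    (h : f.hom ≫ k.hom = g.hom ≫ (func e ⊗ₘ det e')) :
    NormalVia g k f.hom ∧ NormalVia k g f.inv := by
  constructor
  · rw [NormalVia, h, Iso.inv_hom_id_assoc]
    exact IsNormal.func_tensor _ _
  · have h' : k.inv ≫ f.inv ≫ g.hom = func e.symm ⊗ₘ det e'.symm := by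
      change _ = (funcIso e ⊗ᵢ detIso e').inv
      rw [← cancel_mono (funcIso e ⊗ᵢ detIso e').hom, Iso.inv_hom_id, Category.assoc,
        Category.assoc]
      change _ ≫ _ ≫ _ ≫ (func e ⊗ₘ det e') = _
      rw [← h, Iso.inv_hom_id_assoc, Iso.inv_hom_id]
    rw [NormalVia, h']
    exact IsNormal.func_tensor _ _

theorem inc (S : SubStoch X Y) : NormalVia (frameInfer X) (frameInfer Y) (inc S) := by
  have h : (frameInfer X).inv ≫ FS.inc S ≫ (frameInfer Y).hom = _ ◁ FS.inc S := by
    rw [Iso.inv_comp_eq, frameInfer_hom, frameInfer_hom, Category.assoc, ← whisker_exchange]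
    simp
  rw [NormalVia, h]
  exact IsNormal.whiskerLeft _

theorem isNormal_pair (A X : FinSys.{u}) :
    IsNormal (frameTensor (frameCausal A) (frameInfer X)).hom ∧
      IsNormal (frameTensor (frameCausal A) (frameInfer X)).inv := by
  have h := frame_pair A X
  constructor
  · rw [← Iso.eq_comp_inv, Category.id_comp] at h
    rw [h]
    exact IsNormal.func_tensor (P := Ob.infer X) _ (det (X := X) (Y := FinSys.star.prod X)
      (Equiv.punitProd X).symm)
  · rw [← Iso.eq_inv_comp, Category.comp_id] at h
    rw [← h]
    exact IsNormal.func_tensor (Q := Ob.infer X) _ (det (X := FinSys.star.prod X) (Y := X)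
      (Equiv.punitProd X))

theorem know (A B : FinSys.{u}) :
    NormalVia (frameTensor (frameCausal A) (frameInfer _)) (frameCausal B) (knowHom A B) := by
  refine (isNormal_pair A (A.fn B)).2.comp ?_
  -- The trivial inferential output of the gathered target is created before the `know`, which gives
  -- the shape required by `comp_know`.
  have h : knowHom A B ≫ (frameCausal B).hom =
      Ob.causal A ◁ ((ρ_ _).inv ≫ _ ◁ inferStar.hom) ≫ knowOn A B _ := by
    rw [frameCausal_hom, knowOn, rightUnitor_inv_naturality_assoc, ← whisker_exchange]
    monoidal
  rw [h]
  exact IsNormal.comp_know _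

theorem ask (A : FinSys.{u}) :
    NormalVia (frameCausal A) (frameTensor (frameCausal A) (frameInfer A)) (askHom A) := by
  rw [NormalVia, ← Category.assoc]
  refine IsNormal.comp ?_ (isNormal_pair A A).1
  have h : (frameCausal A).inv ≫ askHom A =
      askOn A _ ≫ Ob.causal A ◁ (_ ◁ inferStar.inv ≫ (ρ_ _).hom) := by
    rw [frameCausal_inv, askOn, Category.assoc, ← rightUnitor_naturality,
      whisker_exchange_assoc]
    monoidal
  rw [h]
  exact IsNormal.ask_comp _

theorem pt_del {X : FinSys.{u}} (x : X) : pt x ≫ del X = 𝟙 _ := by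
  have h : det (X := FinSys.star) (fun _ => x) ≫ det (Y := FinSys.star) (fun _ => PUnit.unit) =
      𝟙 _ := by rw [det_comp]; exact det_id
  rw [pt, del, Category.assoc, reassoc_of% h, Iso.hom_inv_id]

theorem ignore (A : FinSys.{u}) : NormalVia (frameCausal A) frameUnit (ignoreHom A) := by
  -- Ignoring is the embedded function to the one-point set: `ignore_know` applied to that function
  -- discards the point distribution, and ignoring the one-point system is removing a trivial wire.
  have h : ignoreHom A ≫ causalStar.hom = func fun _ => PUnit.unit := by
    rw [← Iso.eq_comp_inv, ← ignore_star, func_eq, Category.assoc, Category.assoc, ignore_know,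
      MonoidalCategory.tensorHom_def', Category.assoc, ← MonoidalCategory.whiskerLeft_comp_assoc,
      pt_del]
    rw [MonoidalCategory.whiskerLeft_id, Category.id_comp, unitors_equal, rightUnitor_naturality,
      Iso.inv_hom_id_assoc]
  have h' : (frameCausal A).inv ≫ ignoreHom A ≫ frameUnit.hom =
      (func (B := FinSys.star) fun _ => PUnit.unit) ▷ Ob.infer FinSys.star := by
    rw [Iso.inv_comp_eq, frameUnit_hom, frameCausal_hom, ← h, comp_whiskerRight, Category.assoc,
      whisker_exchange_assoc, tensorHom_def', unitors_inv_equal,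
      rightUnitor_inv_naturality_assoc]
  rw [NormalVia, h']
  exact IsNormal.func_whiskerRight _

/-- `IsNormal.tensor_left` keeps the inferential wires of the two bundles separate; merging them
before and after is itself a normal morphism. -/
theorem whiskerLeft {f : a ⟶ b} (hf : NormalVia g k f) (l : c ≅ Ob.causal C ⊗ Ob.infer Z) :
    NormalVia (frameTensor l g) (frameTensor l k) (c ◁ f) := by
  obtain ⟨f', hf', h⟩ := hf.tensor_left C (Ob.infer Z)
  have e : (frameTensor l g).inv ≫ c ◁ f ≫ (frameTensor l k).hom =
      Ob.causal _ ◁ (inferProd _ _).inv ≫ f' ≫ Ob.causal _ ◁ (inferProd _ _).hom := by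
    have h1 : (l.hom ⊗ₘ g.hom) ≫ _ ◁ (g.inv ≫ f ≫ k.hom) = c ◁ f ≫ (l.hom ⊗ₘ k.hom) := by
      rw [← id_tensorHom, ← id_tensorHom, tensorHom_comp_tensorHom, tensorHom_comp_tensorHom,
        Iso.hom_inv_id_assoc, Category.comp_id, Category.id_comp]
    have h2 : ((causalProd C A).hom ⊗ₘ (inferProd Z X).hom) ≫ _ ◁ (inferProd Z X).inv =
        (causalProd C A).hom ▷ _ := by
      rw [MonoidalCategory.tensorHom_def, Category.assoc, ← MonoidalCategory.whiskerLeft_comp,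
        Iso.hom_inv_id, MonoidalCategory.whiskerLeft_id, Category.comp_id]
    rw [Iso.inv_comp_eq, frameTensor_hom, frameTensor_hom, Category.assoc, Category.assoc,
      reassoc_of% h2, ← reassoc_of% h, reassoc_of% h1, MonoidalCategory.tensorHom_def
        (causalProd C B).hom]
  rw [NormalVia, e]
  exact (IsNormal.whiskerLeft _).comp (hf'.comp (IsNormal.whiskerLeft _))

theorem braiding (g : a ≅ Ob.causal A ⊗ Ob.infer X) (k : b ≅ Ob.causal B ⊗ Ob.infer Y) :
    NormalVia (frameTensor g k) (frameTensor k g) (β_ a b).hom :=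
  (of_equiv (A := A.prod B) (B := B.prod A) (X := X.prod Y) (Y := Y.prod X) _
    (Equiv.prodComm A B) (Equiv.prodComm X Y) (frame_braiding g k)).1

theorem associator (g : a ≅ Ob.causal A ⊗ Ob.infer X) (k : b ≅ Ob.causal B ⊗ Ob.infer Y)
    (l : c ≅ Ob.causal C ⊗ Ob.infer Z) :
    NormalVia (frameTensor (frameTensor g k) l) (frameTensor g (frameTensor k l))
        (α_ a b c).hom ∧
      NormalVia (frameTensor g (frameTensor k l)) (frameTensor (frameTensor g k) l)
        (α_ a b c).inv :=
  of_equiv (A := (A.prod B).prod C) (B := A.prod (B.prod C)) (X := (X.prod Y).prod Z)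
    (Y := X.prod (Y.prod Z)) _ (Equiv.prodAssoc A B C) (Equiv.prodAssoc X Y Z)
    (frame_associator g k l)

theorem leftUnitor (g : a ≅ Ob.causal A ⊗ Ob.infer X) :
    NormalVia (frameTensor frameUnit g) g (λ_ a).hom ∧
      NormalVia g (frameTensor frameUnit g) (λ_ a).inv :=
  of_equiv (A := FinSys.star.prod A) (X := FinSys.star.prod X) _ (Equiv.punitProd A)
    (Equiv.punitProd X) (frame_leftUnitor g)

theorem rightUnitor (g : a ≅ Ob.causal A ⊗ Ob.infer X) :
    NormalVia (frameTensor g frameUnit) g (ρ_ a).hom ∧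
      NormalVia g (frameTensor g frameUnit) (ρ_ a).inv :=
  of_equiv (A := A.prod FinSys.star) (X := X.prod FinSys.star) _ (Equiv.prodPUnit A)
    (Equiv.prodPUnit X) (frame_rightUnitor g)

theorem inferProd (X Y : FinSys.{u}) :
    NormalVia (frameTensor (frameInfer X) (frameInfer Y)) (frameInfer (X.prod Y))
        (FS.inferProd X Y).hom ∧
      NormalVia (frameInfer (X.prod Y)) (frameTensor (frameInfer X) (frameInfer Y))
        (FS.inferProd X Y).inv :=
  of_equiv (A := FinSys.star.prod FinSys.star) (B := FinSys.star) _ (Equiv.punitProd _)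
    (Equiv.refl _) (frame_inferProd X Y)

theorem causalProd (A B : FinSys.{u}) :
    NormalVia (frameTensor (frameCausal A) (frameCausal B)) (frameCausal (A.prod B))
        (FS.causalProd A B).hom ∧
      NormalVia (frameCausal (A.prod B)) (frameTensor (frameCausal A) (frameCausal B))
        (FS.causalProd A B).inv :=
  of_equiv (X := FinSys.star.prod FinSys.star) (Y := FinSys.star) _ (Equiv.refl _)
    (Equiv.punitProd _) (frame_causalProd A B)

theorem inferStar :
    NormalVia frameUnit (frameInfer _) FS.inferStar.{u}.hom ∧
      NormalVia (frameInfer _) frameUnit FS.inferStar.{u}.inv :=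
  of_equiv _ (Equiv.refl _) (Equiv.refl _) frame_inferStar

theorem causalStar :
    NormalVia frameUnit (frameCausal _) FS.causalStar.{u}.hom ∧
      NormalVia (frameCausal _) frameUnit FS.causalStar.{u}.inv :=
  of_equiv _ (Equiv.refl _) (Equiv.refl _) frame_causalStar

theorem whiskerRight {f : a ⟶ b} (hf : NormalVia g k f) (l : c ≅ Ob.causal C ⊗ Ob.infer Z) :
    NormalVia (frameTensor g l) (frameTensor k l) (f ▷ c) := by
  -- Conjugation by crossings turns an idle bundle on the right into one on the left.
  have h := (braiding g l).comp ((hf.whiskerLeft l).comp (braiding l k))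
  rwa [BraidedCategory.braiding_naturality_right, SymmetricCategory.symmetry_assoc] at h

theorem tensor {d : Ob.{u}} {D W : FinSys.{u}} {m : d ≅ Ob.causal D ⊗ Ob.infer W} {f : a ⟶ b}
    {f' : c ⟶ d} (hf : NormalVia g k f) (hf' : NormalVia l m f') :
    NormalVia (frameTensor g l) (frameTensor k m) (f ⊗ₘ f') := by
  rw [MonoidalCategory.tensorHom_def]
  exact (hf.whiskerRight l).comp (hf'.whiskerLeft k)

end NormalVia

/-! ### Normal forms of arbitrary diagrams -/

/-- Gathering as an isomorphism. -/
def gatherIso : (a : Ob.{u}) → (a ≅ Ob.causal a.causalPart ⊗ Ob.infer a.inferPart)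
  | Ob.I => frameUnit
  | Ob.causal A => frameCausal A
  | Ob.infer X => frameInfer X
  | Ob.tens a b => frameTensor (gatherIso a) (gatherIso b)

theorem cls_gather : ∀ a : Ob.{u}, cls (gather a) = (gatherIso a).hom
  | Ob.I => rfl
  | Ob.causal _ => rfl
  | Ob.infer _ => rfl
  | Ob.tens a b => by
    simp only [gather, cls_comp, cls_tensor, cls_gather a, cls_gather b, cls_mid]
    rfl

theorem cls_spread : ∀ a : Ob.{u}, cls (spread a) = (gatherIso a).inv
  | Ob.I => rfl
  | Ob.causal _ => rfl
  | Ob.infer _ => rfl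
  | Ob.tens a b => by
    simp only [spread, cls_comp, cls_tensor, cls_spread a, cls_spread b, cls_mid]
    exact (Category.assoc _ _ _).symm

open NormalVia in
theorem normalVia_gatherIso {a b : Ob.{u}} (D : Diag a b) :
    NormalVia (gatherIso a) (gatherIso b) (cls D) := by
  induction D with
  | wire a => exact NormalVia.id (gatherIso a)
  | comp f g hf hg => exact hf.comp hg
  | tensor f g hf hg => exact hf.tensor hg
  | assoc a b c => exact (associator (gatherIso a) (gatherIso b) (gatherIso c)).1
  | assocInv a b c => exact (associator (gatherIso a) (gatherIso b) (gatherIso c)).2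
  | lunit a => exact (leftUnitor (gatherIso a)).1
  | lunitInv a => exact (leftUnitor (gatherIso a)).2
  | runit a => exact (rightUnitor (gatherIso a)).1
  | runitInv a => exact (rightUnitor (gatherIso a)).2
  | braid a b => exact braiding (gatherIso a) (gatherIso b)
  | inferMerge X Y => exact (NormalVia.inferProd X Y).1
  | inferSplit X Y => exact (NormalVia.inferProd X Y).2
  | inferUnit => exact NormalVia.inferStar.1
  | inferCounit => exact NormalVia.inferStar.2
  | causalMerge A B => exact (NormalVia.causalProd A B).1
  | causalSplit A B => exact (NormalVia.causalProd A B).2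
  | causalUnit => exact NormalVia.causalStar.1
  | causalCounit => exact NormalVia.causalStar.2
  | incl S => exact NormalVia.inc S
  | know A B => exact know A B
  | ask A => exact ask A
  | ignore A => exact ignore A

/-- Merging the two input wires and the two output wires of the inferential part leaves a morphism
between single wires, hence one substochastic map. -/
theorem IsNormal.exists_normalForm {A B X Y : FinSys.{u}}
    {f : Ob.causal A ⊗ Ob.infer X ⟶ Ob.causal B ⊗ Ob.infer Y} (hf : IsNormal f) :
    ∃ S : SubStoch (A.prod X) ((A.fn B).prod Y), f = cls (normalForm S) := by
  obtain ⟨h, hh, rfl⟩ := hf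
  obtain ⟨S, hS⟩ := exists_inc_of_inferential ((inferProd A X).inv ≫ h ≫ (inferProd _ Y).hom)
  refine ⟨S, ?_⟩
  rw [Iso.inv_comp_eq, ← Iso.eq_comp_inv, Category.assoc] at hS
  rw [hS, askOn, knowOn]
  simp only [normalForm, cls_comp, cls_tensor, cls_wire, cls_assoc, cls_assocInv]
  change _ = (askHom A ⊗ₘ 𝟙 _) ≫ (α_ _ _ _).hom ≫
    (𝟙 _ ⊗ₘ ((inferProd A X).hom ≫ inc S ≫ (inferProd _ Y).inv)) ≫ (α_ _ _ _).inv ≫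
      (knowHom A B ⊗ₘ 𝟙 _)
  simp only [tensorHom_id, id_tensorHom, Category.assoc]

end FS

theorem theorem3 :
    (∀ (A B X Y : FS.FinSys.{u})
      (D : FS.Diag (FS.Ob.tens (FS.Ob.causal A) (FS.Ob.infer X))
        (FS.Ob.tens (FS.Ob.causal B) (FS.Ob.infer Y))),
      ∃ S : FS.SubStoch (A.prod X) ((A.fn B).prod Y), FS.Rewrites D (FS.normalForm S)) ∧
    (∀ (a b : FS.Ob.{u}) (D : FS.Diag a b),
      ∃ S : FS.SubStoch (a.causalPart.prod a.inferPart)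
          ((a.causalPart.fn b.causalPart).prod b.inferPart),
        FS.Rewrites D (FS.gather a ;; FS.normalForm S ;; FS.spread b)) := by
  constructor
  · intro A B X Y D
    have h : FS.NormalVia (FS.frameTensor (FS.frameCausal A) (FS.frameInfer X))
        (FS.frameTensor (FS.frameCausal B) (FS.frameInfer Y)) (FS.cls D) :=
      FS.normalVia_gatherIso D
    -- Induction shows only the padded version of `D` to be normal. Padding the input and unpadding
    -- the output are normal too, and composing with them recovers `D` itself.
    obtain ⟨S, hS⟩ := ((FS.NormalVia.isNormal_pair A X).1.comp
      (FS.IsNormal.comp h (FS.NormalVia.isNormal_pair B Y).2)).exists_normalForm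
    refine ⟨S, FS.rewrites_of_cls_eq ?_⟩
    rw [← hS]
    simp
  · intro a b D
    obtain ⟨S, hS⟩ := (FS.normalVia_gatherIso D).exists_normalForm
    refine ⟨S, FS.rewrites_of_cls_eq ?_⟩
    rw [FS.cls_comp, FS.cls_comp, FS.cls_gather, FS.cls_spread, ← hS]
    simp
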